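/- Let $k\ge 4$ be an integer. There are constants $c_9(k),c_{10}(k)>0$, depending on $k$ only, with the following property. Let $H$ be a real separable Hilbert space with inner product $(\cdot,\cdot)$ and norm $|\cdot|$, and let $Y$ be an $H$-valued Gaussian random element with zero mean and covariance operator $V$, i.e. $(Vx,z)=\mathbf E\,(Y,x)(Y,z)$ for $x,z\in H$. Let $e_1,e_2,\dots$ be a complete orthonormal system of eigenvectors of $V$, $Ve_j=\sigma_j^2e_j$ with $\sigma_j\ge 0$, numbered so that $\sigma_1^2=\dots=\sigma_k^2$ is positive and is strictly larger than every $\sigma_j^2$ with $j>k$ (so $k$ is the multiplicity of the largest eigenvalue), and let $\sigma_{k+1}^2$ be the largest of the eigenvalues $\sigma_j^2$, $j>k$ ($0$ if there are none). Let $a\in H$, and put $Y_j=(Y,e_j)$, $a_j=(a,e_j)$, $|\overline a_k|=(a_1^2+\dots+a_k^2)^{1/2}$, $$R=\sum_{j>k}(Y_j-a_j)^2,\qquad u_0=2k\Bigl(1-\frac{\sigma_{k+1}^2}{\sigma_1^2}\Bigr)^{-2}\mathbf E R,\qquad u^{**}=\frac{5.625\,(k-1)^2}{k-3}\,u_0+\frac{16\,|\overline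 a_k|^2u_0^2}{\sigma_1^4\,(k-3)^2}.$$ If $|\overline a_k|>0$ and $r>\sigma_1^2/|\overline a_k|+2|\overline a_k|+(u^{**})^{1/2}$, then $\mathbf E\exp\{R/(2\sigma_1^2)\}<\infty$ and $$c_9(k)\,\mathbf E\exp\Bigl\{\frac{R}{2\sigma_1^2}\Bigr\}\le \mathbf P(|Y-a|>r)\,\exp\Bigl\{\frac{(r-|\overline a_k|)^2}{2\sigma_1^2}\Bigr\}\,\sigma_1^{-1}\,r^{-(k-3)/2}\,|\overline a_k|^{(k-1)/2}\le c_{10}(k)\,\mathbf E\exp\Bigl\{\frac{R}{2\sigma_1^2}\Bigr\}.$$ -/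

import Mathlib

open MeasureTheory ProbabilityTheory
open scoped RealInnerProductSpace

namespace GaussianTail

noncomputable section

variable {ι H : Type*} [NormedAddCommGroup H] [InnerProductSpace ℝ H]

/-- `e` is a complete orthonormal system of eigenvectors of `V` with eigenvalues `σ j ^ 2`
(where `σ j ≥ 0`); the largest eigenvalue is `σ₁ ^ 2 > 0`, and `S` is the set of all indices `j`
with `σ j = σ₁`. With the usual numbering of the eigenvalues in decreasing order,
`S = {1, …, k}` where `k` is the multiplicity of `σ₁ ^ 2`. -/
structure IsEigenbasis (V : H →L[ℝ] H) (e : HilbertBasis ι ℝ H) (σ : ι → ℝ) (σ₁ : ℝ)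
    (S : Finset ι) : Prop where
  eigen : ∀ j, V (e j) = (σ j ^ 2) • e j
  nonneg : ∀ j, 0 ≤ σ j
  pos : 0 < σ₁
  top : ∀ j ∈ S, σ j = σ₁
  lt_top : ∀ j, j ∉ S → σ j < σ₁

/-- `|ā_k|`: the Euclidean norm of the vector of the coordinates `(a, e_j)`, `j ∈ S`. -/
def topNorm (e : HilbertBasis ι ℝ H) (S : Finset ι) (a : H) : ℝ :=
  √(∑ j ∈ S, ⟪a, e j⟫ ^ 2)

/-- The value of `R = ∑_{j ∉ S} (Y_j - a_j)²` when `Y` takes the value `y`; here `Y_j = (Y, e_j)`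
and `a_j = (a, e_j)`. -/
def remainder (e : HilbertBasis ι ℝ H) (S : Finset ι) (a y : H) : ℝ :=
  ∑' j : {j : ι // j ∉ S}, (⟪y, e j⟫ - ⟪a, e j⟫) ^ 2

/-- `σ_{k+1}²`: the largest of the eigenvalues `σ j ^ 2` with `j ∉ S` (`0` if there are none). -/
def nextEigenvalue (σ : ι → ℝ) (S : Finset ι) : ℝ :=
  ⨆ j : {j : ι // j ∉ S}, σ j ^ 2

/-- `u₀ = 2 k (1 - σ_{k+1}² / σ₁²)⁻² E R`, as a function of `k`, `σ₁² = v₁`, `σ_{k+1}² = v₂`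
and `E R = m`. -/
def u₀ (k : ℕ) (v₁ v₂ m : ℝ) : ℝ :=
  2 * k * ((1 - v₂ / v₁) ^ 2)⁻¹ * m

/-- `u** = 5.625 (k-1)² (k-3)⁻¹ u₀ + 16 |ā_k|² σ₁⁻⁴ u₀² (k-3)⁻²`, as a function of `k`, `σ₁`,
`|ā_k| = A` and `u₀ = u`. -/
def uStarStar (k : ℕ) (σ₁ A u : ℝ) : ℝ :=
  5.625 * ((k : ℝ) - 1) ^ 2 / ((k : ℝ) - 3) * u
    + 16 * A ^ 2 / σ₁ ^ 4 * u ^ 2 / ((k : ℝ) - 3) ^ 2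

end

end GaussianTail

open scoped ENNReal

namespace GaussianTail

/-! Parseval splits the squared distance as `‖Y - a‖² = σ₁² T + R`. Here `T` collects the `k` top
coordinates, has unit variance in each direction, and is independent of `R`. Rotating the top
eigenspace so that one axis lies along the projection of `a` makes `T` noncentral chi-square with
`k` degrees of freedom and shift `A / σ₁`, where `A` is the norm of that projection. Conditioning on
`R` expresses the probability as the mean of the tail of `T` beyond `(r² - R) / σ₁²`
(`IsEigenbasis.measure_norm_sub_gt`).

In units where `σ₁ = 1`, the tail of `T` beyond `r² - u` is `exp (u / 2)` times its order of
magnitude at `u = 0`, up to constants (`exists_noncentralChiSq_tail_bounds`). The upper bound holds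
for every `u ≥ 0`, so averaging over `R` gives the upper estimate at once. The lower bound needs `u
≤ r² / 2` and `A u ≤ B r`, so it can be used only where `R` is below a level `U`.

It remains to see that `{R ≤ U}` carries at least half of `E exp (R / (2 σ₁²))`. This is Markov's
inequality under the law with density proportional to `exp (R / (2 σ₁²))`
(`lintegral_le_two_mul_setLIntegral`). Tilting keeps each coordinate Gaussian and multiplies its
second moment by at most `κ²`, where `κ = (1 - σ_{k+1}² / σ₁²)⁻¹`; hence the tilted mean of `R` is
at most `κ² E R` (`IsEigenbasis.lintegral_remainder_mul_exp_le`). The level is `U = u₀`, and the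
threshold on `r` is what makes it admissible (`threshold_bounds`). -/

/-! ### Law of a sum of squares of standard Gaussians -/

/-- The chi-squared density with `d` degrees of freedom, up to normalization. -/
noncomputable def chiSqKernel (d q : ℝ) : ℝ≥0∞ :=
  (Set.Ioi 0).indicator (fun q : ℝ => ENNReal.ofReal (q ^ (d / 2 - 1) * Real.exp (-q / 2))) q

@[fun_prop]
lemma measurable_chiSqKernel (d : ℝ) : Measurable (chiSqKernel d) := by
  unfold chiSqKernel
  exact Measurable.indicator (by fun_prop) measurableSet_Ioi

lemma chiSqKernel_of_pos {d q : ℝ} (hq : 0 < q) :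
    chiSqKernel d q = ENNReal.ofReal (q ^ (d / 2 - 1) * Real.exp (-q / 2)) := by
  simp [chiSqKernel, hq]

lemma chiSqKernel_of_nonpos {d q : ℝ} (hq : q ≤ 0) : chiSqKernel d q = 0 := by
  simp [chiSqKernel, hq]

/-- Law of `x² + w` for independent `x`, `w` with densities `g`, `h`. -/
lemma lintegral_sq_add {f g h : ℝ → ℝ≥0∞} (hf : Measurable f) (hg : Measurable g)
    (hh : Measurable h) :
    ∫⁻ x, g x * ∫⁻ w, f (x ^ 2 + w) * h w = ∫⁻ q, f q * ∫⁻ x, g x * h (q - x ^ 2) := by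
  calc ∫⁻ x, g x * ∫⁻ w, f (x ^ 2 + w) * h w
      = ∫⁻ x, ∫⁻ q, g x * (f q * h (q - x ^ 2)) := by
        refine lintegral_congr fun x => ?_
        rw [← lintegral_sub_right_eq_self (fun w => f (x ^ 2 + w) * h w) (x ^ 2),
          ← lintegral_const_mul _ (by fun_prop)]
        simp
    _ = ∫⁻ q, ∫⁻ x, g x * (f q * h (q - x ^ 2)) :=
        lintegral_lintegral_swap (by fun_prop)
    _ = _ := by
        refine lintegral_congr fun q => ?_
        rw [← lintegral_const_mul _ (by fun_prop)]
        refine lintegral_congr fun x => ?_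
        ring

lemma lintegral_comp_mul_left {f : ℝ → ℝ≥0∞} (hf : Measurable f) {c : ℝ} (hc : 0 < c) :
    ∫⁻ x, f x = ENNReal.ofReal c * ∫⁻ x, f (c * x) := by
  have h := Real.map_volume_mul_left hc.ne'
  have h2 : ∫⁻ x, f x ∂(Measure.map (c * ·) volume) = ∫⁻ x, f (c * x) :=
    lintegral_map hf (by fun_prop)
  rw [← h2, h, lintegral_smul_measure, smul_eq_mul, ← mul_assoc, ← ENNReal.ofReal_mul hc.le,
    abs_of_pos (inv_pos.2 hc), mul_inv_cancel₀ hc.ne', ENNReal.ofReal_one, one_mul]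

lemma gaussianPDF_zero_one_eq (x : ℝ) : gaussianPDF 0 1 x =
    ENNReal.ofReal ((√(2 * Real.pi))⁻¹ * Real.exp (-x ^ 2 / 2)) := by
  simp [gaussianPDF, gaussianPDFReal]

/-- The substitution `x = √q y` merges the two exponentials into `exp (-q / 2)` and pulls out the
power of `q`, leaving a Beta-type integral free of `q`. The constant is only claimed in `[0, ∞]`, so
its convergence need not be examined; normalization settles it later. -/
lemma lintegral_gaussianPDF_mul_chiSqKernel (d : ℝ) : ∃ C : ℝ≥0∞, ∀ q : ℝ,
    ∫⁻ x, gaussianPDF 0 1 x * chiSqKernel d (q - x ^ 2) = C * chiSqKernel (d + 1) q := by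
  refine ⟨∫⁻ y, ENNReal.ofReal ((√(2 * Real.pi))⁻¹) *
    (if y ^ 2 < 1 then ENNReal.ofReal ((1 - y ^ 2) ^ (d / 2 - 1)) else 0), fun q => ?_⟩
  rcases le_or_gt q 0 with hq | hq
  · rw [chiSqKernel_of_nonpos hq, mul_zero]
    refine (lintegral_congr fun x => ?_).trans lintegral_zero
    rw [chiSqKernel_of_nonpos (by nlinarith [sq_nonneg x]), mul_zero]
  · have hm : Measurable fun x => gaussianPDF 0 1 x * chiSqKernel d (q - x ^ 2) :=
      (measurable_gaussianPDF 0 1).mul ((measurable_chiSqKernel d).comp (by fun_prop))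
    rw [lintegral_comp_mul_left hm (Real.sqrt_pos.2 hq), ← lintegral_const_mul _ (by fun_prop),
      ← lintegral_mul_const _ (Measurable.const_mul (Measurable.ite
        (measurableSet_lt (by fun_prop) (by fun_prop)) (by fun_prop) (by fun_prop)) _)]
    refine lintegral_congr fun y => ?_
    have hs : (√q * y) ^ 2 = q * y ^ 2 := by rw [mul_pow, Real.sq_sqrt hq.le]
    rw [hs, gaussianPDF_zero_one_eq, chiSqKernel_of_pos hq, hs]
    split_ifs with hy
    · have h1 : 0 < 1 - y ^ 2 := by linarith
      have h2 : q - q * y ^ 2 = q * (1 - y ^ 2) := by ring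
      rw [chiSqKernel_of_pos (by rw [h2]; positivity), h2, ← ENNReal.ofReal_mul (by positivity),
        ← ENNReal.ofReal_mul (by positivity), ← ENNReal.ofReal_mul (by positivity),
        ← ENNReal.ofReal_mul (by positivity)]
      congr 1
      have e1 : (d + 1) / 2 - 1 = (d / 2 - 1) + 1 / 2 := by ring
      rw [e1, Real.rpow_add hq, Real.mul_rpow hq.le h1.le, ← Real.sqrt_eq_rpow]
      have e2 : Real.exp (-q / 2) = Real.exp (-(q * y ^ 2) / 2) *
          Real.exp (-(q * (1 - y ^ 2)) / 2) := by
        rw [← Real.exp_add]; congr 1; ring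
      rw [e2]; ring
    · rw [chiSqKernel_of_nonpos (by nlinarith), mul_zero, mul_zero, mul_zero, zero_mul]

/-- Evenness folds the integral onto the positive half-line, where `x = √q` has Jacobian `1 / (2
√q)`; the `2` cancels and `q ^ (-1 / 2)` is the kernel's power for `d = 1`. -/
lemma lintegral_sq_gaussianReal {f : ℝ → ℝ≥0∞} (hf : Measurable f) :
    ∫⁻ x, f (x ^ 2) ∂(gaussianReal 0 1) =
      ENNReal.ofReal ((√(2 * Real.pi))⁻¹) * ∫⁻ q, f q * chiSqKernel 1 q := by
  rw [gaussianReal_of_var_ne_zero 0 one_ne_zero,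
    lintegral_withDensity_eq_lintegral_mul _ (measurable_gaussianPDF 0 1) (by fun_prop)]
  set G : ℝ → ℝ≥0∞ := fun x => gaussianPDF 0 1 x * f (x ^ 2) with hG
  have hGm : Measurable G := by fun_prop
  have heven : ∀ x, G (-x) = G x := fun x => by simp [hG, gaussianPDF_zero_one_eq]
  have hsplit : ∫⁻ x, G x = 2 * ∫⁻ x in Set.Ioi 0, G x := by
    rw [← lintegral_add_compl G (measurableSet_Ioi (a := (0 : ℝ))), two_mul]
    congr 1
    rw [Set.compl_Ioi, setLIntegral_congr Iio_ae_eq_Iic.symm,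
      ← lintegral_indicator measurableSet_Iio, ← lintegral_indicator measurableSet_Ioi,
      ← lintegral_neg_eq_self]
    refine lintegral_congr fun x => ?_
    by_cases hx : 0 < x <;> simp [Set.indicator, hx, heven]
  have himage : Real.sqrt '' Set.Ioi 0 = Set.Ioi 0 := by
    ext x
    constructor
    · rintro ⟨y, hy, rfl⟩
      exact Real.sqrt_pos.2 hy
    · intro hx
      exact ⟨x ^ 2, Set.mem_Ioi.2 (pow_pos hx 2), Real.sqrt_sq (le_of_lt hx)⟩
  have hchange : ∫⁻ x in Set.Ioi 0, G x =
      ∫⁻ q in Set.Ioi (0 : ℝ), ENNReal.ofReal |1 / (2 * √q)| * G (√q) := by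
    conv_lhs => rw [← himage]
    exact lintegral_image_eq_lintegral_abs_deriv_mul measurableSet_Ioi
      (fun x hx => (Real.hasDerivAt_sqrt (ne_of_gt hx)).hasDerivWithinAt)
      (fun x hx y hy h => (Real.sqrt_inj (le_of_lt hx) (le_of_lt hy)).1 h) G
  change ∫⁻ x, G x = _
  rw [hsplit, hchange, ← lintegral_const_mul _ (by fun_prop), ← lintegral_const_mul
    _ (f := fun q => f q * chiSqKernel 1 q) (by fun_prop), ← lintegral_indicator measurableSet_Ioi]
  refine lintegral_congr fun q => ?_
  by_cases hq : 0 < q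
  · have h2 : (2 : ℝ≥0∞) = ENNReal.ofReal 2 := by simp
    have hs := Real.sqrt_pos.2 hq
    rw [Set.indicator_of_mem (Set.mem_Ioi.2 hq), chiSqKernel_of_pos hq, hG]
    simp only [Real.sq_sqrt hq.le, gaussianPDF_zero_one_eq]
    rw [mul_comm (f q), ← mul_assoc, ← mul_assoc, ← mul_assoc, h2,
      ← ENNReal.ofReal_mul (by positivity), ← ENNReal.ofReal_mul (by positivity),
      ← ENNReal.ofReal_mul (by positivity)]
    congr 2
    have e1 : (1 : ℝ) / 2 - 1 = -(1 / 2) := by norm_num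
    rw [e1, Real.rpow_neg hq.le, ← Real.sqrt_eq_rpow, abs_of_pos (by positivity)]
    field_simp
  · rw [Set.indicator_of_notMem (by simpa using hq), chiSqKernel_of_nonpos (not_lt.1 hq)]
    simp

lemma lintegral_sum_sq_pi_gaussianReal (n : ℕ) : ∃ C : ℝ≥0∞, ∀ f : ℝ → ℝ≥0∞, Measurable f →
    ∫⁻ z, f (∑ i, z i ^ 2) ∂(Measure.pi fun _ : Fin (n + 1) => gaussianReal 0 1) =
      C * ∫⁻ q, f q * chiSqKernel (n + 1) q := by
  induction n with
  | zero =>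
    refine ⟨ENNReal.ofReal ((√(2 * Real.pi))⁻¹), fun f hf => ?_⟩
    have h := (measurePreserving_funUnique (gaussianReal 0 1) (Fin 1)).lintegral_comp
      (f := fun x => f (x ^ 2)) (by fun_prop)
    simp only [Nat.cast_zero, zero_add]
    rw [← lintegral_sq_gaussianReal hf, ← h]
    simp only [Fin.default_eq_zero, MeasurableEquiv.funUnique_apply]
    congr!
    exact Fin.sum_univ_one _
  | succ n ih =>
    obtain ⟨C, hC⟩ := ih
    obtain ⟨D, hD⟩ := lintegral_gaussianPDF_mul_chiSqKernel (n + 1)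
    refine ⟨C * D, fun f hf => ?_⟩
    have h := (measurePreserving_piFinSuccAbove
      (fun _ : Fin (n + 2) => gaussianReal 0 1) 0).symm.lintegral_comp
      (f := fun z => f (∑ i, z i ^ 2)) (by fun_prop)
    rw [← h, lintegral_prod _ (by fun_prop)]
    have hstep : ∀ x : ℝ, ∫⁻ z, f (∑ i, ((MeasurableEquiv.piFinSuccAbove
        (fun _ : Fin (n + 2) => ℝ) 0).symm (x, z)) i ^ 2)
        ∂(Measure.pi fun _ : Fin (n + 1) => gaussianReal 0 1) =
        C * ∫⁻ w, f (x ^ 2 + w) * chiSqKernel (n + 1) w := by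
      intro x
      rw [← hC (fun w => f (x ^ 2 + w)) (by fun_prop)]
      refine lintegral_congr fun z => ?_
      rw [Fin.sum_univ_succ]
      simp [MeasurableEquiv.piFinSuccAbove]
    have hk := measurable_chiSqKernel (n + 1)
    have hk2 := measurable_chiSqKernel (n + 1 + 1)
    have hin : Measurable fun x : ℝ => ∫⁻ w, f (x ^ 2 + w) * chiSqKernel (n + 1) w :=
      Measurable.lintegral_prod_right' (f := fun p : ℝ × ℝ =>
        f (p.1 ^ 2 + p.2) * chiSqKernel (n + 1) p.2) (by fun_prop)
    refine (lintegral_congr hstep).trans ?_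
    rw [lintegral_const_mul _ hin, gaussianReal_of_var_ne_zero 0 one_ne_zero,
      lintegral_withDensity_eq_lintegral_mul _ (measurable_gaussianPDF 0 1) hin]
    simp only [Pi.mul_apply]
    rw [lintegral_sq_add hf (measurable_gaussianPDF 0 1) hk]
    simp only [hD]
    push_cast
    rw [mul_assoc, ← lintegral_const_mul D (f := fun q => f q * chiSqKernel (n + 1 + 1) q)
      (by fun_prop)]
    congr 1
    refine lintegral_congr fun q => ?_
    ring

/-! ### Two-sided bounds for the noncentral chi-square density -/

/-- The integral of `exp (A x) (q - x²) ^ m` over `x² < q`. -/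
noncomputable def expSphereIntegral (A m q : ℝ) : ℝ≥0∞ :=
  ∫⁻ x, ENNReal.ofReal (Real.exp (A * x)) *
    (if x ^ 2 < q then ENNReal.ofReal ((q - x ^ 2) ^ m) else 0)

/-- The mass sits near `x = √q`. With `x = √q - v` one has `q - x² = v (2 √q - v) ≤ 2 √q v`, so the
integrand is at most a constant multiple of the Gamma density of shape `m + 1` and rate `A`, whose
total mass is one. -/
lemma expSphereIntegral_le {A m q : ℝ} (hA : 0 < A) (hm : 0 ≤ m) (hq : 0 < q) :
    expSphereIntegral A m q ≤ ENNReal.ofReal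
      (2 ^ m * Real.Gamma (m + 1) * (A ^ (-(m + 1)) * Real.exp (A * √q) * q ^ (m / 2))) := by
  have hs := Real.sqrt_pos.2 hq
  have hG : 0 < Real.Gamma (m + 1) := Real.Gamma_pos_of_pos (by linarith)
  have hqm : (√q) ^ m = q ^ (m / 2) := by
    rw [Real.sqrt_eq_rpow, ← Real.rpow_mul hq.le]; congr 1; ring
  rw [← mul_one (ENNReal.ofReal _), ← lintegral_gammaPDF_eq_one (a := m + 1) (by linarith) hA,
    ← lintegral_const_mul' _ _ ENNReal.ofReal_ne_top, expSphereIntegral,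
    ← lintegral_sub_left_eq_self _ (√q)]
  refine lintegral_mono fun v => ?_
  simp only
  split_ifs with h
  · have hlt : |√q - v| < √q := by
      rw [← Real.sqrt_sq_eq_abs]
      exact Real.sqrt_lt_sqrt (sq_nonneg _) h
    obtain ⟨h1, h2⟩ := abs_lt.1 hlt
    have hv : 0 < v := by linarith
    have hfac : q - (√q - v) ^ 2 = v * (2 * √q - v) := by
      nlinarith [Real.sq_sqrt hq.le]
    rw [gammaPDF_of_nonneg hv.le, ← ENNReal.ofReal_mul (by positivity),
      ← ENNReal.ofReal_mul (by positivity), hfac]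
    refine ENNReal.ofReal_le_ofReal ?_
    have e1 : Real.exp (A * (√q - v)) = Real.exp (A * √q) * Real.exp (-(A * v)) := by
      rw [← Real.exp_add]; congr 1; ring
    have e2 : (v * (2 * √q - v)) ^ m ≤ v ^ m * (2 ^ m * q ^ (m / 2)) := by
      rw [Real.mul_rpow hv.le (by linarith), ← hqm, ← Real.mul_rpow (by norm_num) hs.le]
      exact mul_le_mul_of_nonneg_left (Real.rpow_le_rpow (by linarith) (by linarith) hm)
        (by positivity)
    have e3 : A ^ (-(m + 1)) * A ^ (m + 1) = 1 := by
      rw [← Real.rpow_add hA]; simp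
    have e4 : m + 1 - 1 = m := by ring
    rw [e1, e4]
    calc Real.exp (A * √q) * Real.exp (-(A * v)) * (v * (2 * √q - v)) ^ m
        ≤ Real.exp (A * √q) * Real.exp (-(A * v)) * (v ^ m * (2 ^ m * q ^ (m / 2))) := by gcongr
      _ = (A ^ (-(m + 1)) * A ^ (m + 1)) *
            (Real.exp (A * √q) * Real.exp (-(A * v)) * (v ^ m * (2 ^ m * q ^ (m / 2)))) := by
          rw [e3, one_mul]
      _ = _ := by field_simp
  · simp

lemma le_expSphereIntegral {A m q : ℝ} (hA : 0 < A) (hm : 0 ≤ m) (hq : 1 / 2 ≤ A * √q) :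
    ENNReal.ofReal ((1 / 4) ^ (m + 1) * Real.exp (-1 / 2) *
      (A ^ (-(m + 1)) * Real.exp (A * √q) * q ^ (m / 2))) ≤ expSphereIntegral A m q := by
  have hs : 0 < √q := by
    by_contra h
    nlinarith [not_lt.1 h]
  have hq0 : 0 < q := Real.sqrt_pos.1 hs
  have hqm : (√q) ^ m = q ^ (m / 2) := by
    rw [Real.sqrt_eq_rpow, ← Real.rpow_mul hq0.le]; congr 1; ring
  have hle : 1 / (2 * A) ≤ √q := by
    rw [div_le_iff₀ (by positivity)]; linarith
  -- On this window of length `1 / (4A)` the exponential loses at most `exp (-1 / 2)`, while `q - x²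
  -- ≥ √q / (4A)`; `1 / 2 ≤ A √q` keeps the window in `x ≥ 0`.
  set a := √q - 1 / (2 * A) with ha
  set b := √q - 1 / (4 * A) with hb
  have hab : b - a = 1 / (4 * A) := by rw [ha, hb]; field_simp; ring
  calc ENNReal.ofReal ((1 / 4) ^ (m + 1) * Real.exp (-1 / 2) *
      (A ^ (-(m + 1)) * Real.exp (A * √q) * q ^ (m / 2)))
      = ∫⁻ x in Set.Icc a b, ENNReal.ofReal
          (Real.exp (A * √q - 1 / 2) * (√q * (1 / (4 * A))) ^ m) := by
        rw [setLIntegral_const, Real.volume_Icc, ← ENNReal.ofReal_mul (by positivity), hab]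
        congr 1
        have e1 : Real.exp (A * √q - 1 / 2) = Real.exp (A * √q) * Real.exp (-1 / 2) := by
          rw [← Real.exp_add]; congr 1; ring
        have e2 : (1 : ℝ) / (4 * A) = 1 / 4 * A⁻¹ := by field_simp
        rw [e1, Real.mul_rpow hs.le (by positivity), hqm, e2,
          Real.mul_rpow (by norm_num) (by positivity), Real.rpow_add (by norm_num : (0:ℝ) < 1 / 4),
          neg_add, Real.rpow_add hA, Real.inv_rpow hA.le, ← Real.rpow_neg hA.le, Real.rpow_neg_one,
          Real.rpow_one]
        ring
    _ ≤ ∫⁻ x in Set.Icc a b, ENNReal.ofReal (Real.exp (A * x)) *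
          (if x ^ 2 < q then ENNReal.ofReal ((q - x ^ 2) ^ m) else 0) := by
        refine setLIntegral_mono' measurableSet_Icc fun x hx => ?_
        have hx0 : 0 ≤ x := by linarith [hx.1]
        have h4 : 0 < 1 / (4 * A) := by positivity
        have hx1 : 1 / (4 * A) ≤ √q - x := by linarith [hx.2]
        have hfac : q - x ^ 2 = (√q + x) * (√q - x) := by
          nlinarith [Real.sq_sqrt hq0.le]
        have hlt : x ^ 2 < q := by nlinarith
        rw [if_pos hlt, ← ENNReal.ofReal_mul (by positivity)]
        refine ENNReal.ofReal_le_ofReal ?_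
        have hexp : A * √q - 1 / 2 ≤ A * x := by
          have := mul_le_mul_of_nonneg_left hx.1 hA.le
          have h5 : A * a = A * √q - 1 / 2 := by rw [ha]; field_simp
          linarith
        have : √q * (1 / (4 * A)) ≤ q - x ^ 2 := by
          rw [hfac]
          gcongr
          linarith
        gcongr
    _ ≤ _ := setLIntegral_le_lintegral _ _

/-- The law of `x² + ∑ zᵢ²` for independent `x ∼ N(A, 1)` and `z₀, …, zₙ ∼ N(0, 1)`. -/
noncomputable def noncentralChiSq (n : ℕ) (A : ℝ) : Measure ℝ :=
  ((gaussianReal A 1).prod (Measure.pi fun _ : Fin (n + 1) => gaussianReal 0 1)).map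
    fun p => p.1 ^ 2 + ∑ i, p.2 i ^ 2

instance (n : ℕ) (A : ℝ) : IsProbabilityMeasure (noncentralChiSq n A) :=
  Measure.isProbabilityMeasure_map (by fun_prop)

/-- The order of magnitude of the density of `noncentralChiSq`, with `m = (n - 1) / 2`. -/
noncomputable def noncentralKernel (A m q : ℝ) : ℝ :=
  A ^ (-(m + 1)) * Real.exp (-(A ^ 2 + q) / 2 + A * √q) * q ^ (m / 2)

/-- The quadratic terms in `x` cancel between the two exponents, so only the linear exponent `A x`
survives under the integral. -/
lemma gaussianPDF_mul_chiSqKernel (A d q x : ℝ) :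
    gaussianPDF A 1 x * chiSqKernel d (q - x ^ 2) =
      ENNReal.ofReal ((√(2 * Real.pi))⁻¹ * Real.exp (-(A ^ 2 + q) / 2)) *
        (ENNReal.ofReal (Real.exp (A * x)) *
          (if x ^ 2 < q then ENNReal.ofReal ((q - x ^ 2) ^ (d / 2 - 1)) else 0)) := by
  split_ifs with h
  · have hp : 0 < q - x ^ 2 := by linarith
    rw [chiSqKernel_of_pos hp, gaussianPDF, gaussianPDFReal, ← ENNReal.ofReal_mul (by positivity),
      ← ENNReal.ofReal_mul (by positivity), ← ENNReal.ofReal_mul (by positivity)]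
    congr 1
    have e : Real.exp (-(x - A) ^ 2 / (2 * 1)) * Real.exp (-(q - x ^ 2) / 2) =
        Real.exp (-(A ^ 2 + q) / 2) * Real.exp (A * x) := by
      rw [← Real.exp_add, ← Real.exp_add]; congr 1; ring
    simp only [NNReal.coe_one, mul_one] at e ⊢
    linear_combination ((√(2 * Real.pi))⁻¹ * (q - x ^ 2) ^ (d / 2 - 1)) * e
  · rw [chiSqKernel_of_nonpos (by linarith), mul_zero, mul_zero, mul_zero]

lemma exists_lintegral_noncentralChiSq (n : ℕ) : ∃ C : ℝ, 0 < C ∧ ∀ A : ℝ, ∀ f : ℝ → ℝ≥0∞,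
    Measurable f → ∫⁻ q, f q ∂noncentralChiSq n A = ENNReal.ofReal C *
      ∫⁻ q in Set.Ioi 0, f q * (ENNReal.ofReal (Real.exp (-(A ^ 2 + q) / 2)) *
        expSphereIntegral A (((n : ℝ) + 1) / 2 - 1) q) := by
  obtain ⟨C, hC⟩ := lintegral_sum_sq_pi_gaussianReal n
  -- Testing with `f = 1` turns total mass one into an equation that excludes both `C = 0` and `C =
  -- ⊤`.
  have h1 := hC 1 measurable_one
  simp only [Pi.one_apply, lintegral_one, measure_univ, one_mul] at h1
  have hC0 : C ≠ 0 := by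
    rintro rfl
    simp at h1
  have hCt : C ≠ ⊤ := by
    rintro rfl
    rcases eq_or_ne (∫⁻ q, chiSqKernel (n + 1) q) 0 with h | h
    · simp [h] at h1
    · rw [ENNReal.top_mul h] at h1
      simp at h1
  refine ⟨C.toReal * (√(2 * Real.pi))⁻¹,
    mul_pos (ENNReal.toReal_pos hC0 hCt) (by positivity), fun A f hf => ?_⟩
  have hin : Measurable fun x : ℝ => ∫⁻ w, f (x ^ 2 + w) * chiSqKernel (n + 1) w :=
    Measurable.lintegral_prod_right' (f := fun p : ℝ × ℝ =>
      f (p.1 ^ 2 + p.2) * chiSqKernel (n + 1) p.2) (by fun_prop)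
  rw [noncentralChiSq, lintegral_map hf (by fun_prop), lintegral_prod _ (by fun_prop)]
  calc ∫⁻ x, ∫⁻ z : Fin (n + 1) → ℝ, f (x ^ 2 + ∑ i, z i ^ 2)
        ∂(Measure.pi fun _ : Fin (n + 1) => gaussianReal 0 1) ∂gaussianReal A 1
      = ∫⁻ x, (C * ∫⁻ w, f (x ^ 2 + w) * chiSqKernel (n + 1) w) ∂gaussianReal A 1 :=
        lintegral_congr fun x => hC (fun w => f (x ^ 2 + w)) (by fun_prop)
    _ = C * ∫⁻ x, gaussianPDF A 1 x * ∫⁻ w, f (x ^ 2 + w) * chiSqKernel (n + 1) w := by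
        rw [lintegral_const_mul _ hin, gaussianReal_of_var_ne_zero A one_ne_zero,
          lintegral_withDensity_eq_lintegral_mul _ (measurable_gaussianPDF A 1) hin]
        rfl
    _ = C * ∫⁻ q, f q * ∫⁻ x, gaussianPDF A 1 x * chiSqKernel (n + 1) (q - x ^ 2) := by
        rw [lintegral_sq_add hf (measurable_gaussianPDF A 1) (measurable_chiSqKernel _)]
    _ = C * ∫⁻ q, ENNReal.ofReal (√(2 * Real.pi))⁻¹ * (Set.Ioi 0).indicator (fun q => f q *
          (ENNReal.ofReal (Real.exp (-(A ^ 2 + q) / 2)) *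
            expSphereIntegral A (((n : ℝ) + 1) / 2 - 1) q)) q := by
        congr 1
        refine lintegral_congr fun q => ?_
        simp only [gaussianPDF_mul_chiSqKernel]
        rw [lintegral_const_mul' _ _ ENNReal.ofReal_ne_top]
        change f q * (_ * expSphereIntegral A (((n : ℝ) + 1) / 2 - 1) q) = _
        by_cases hq : 0 < q
        · rw [Set.indicator_of_mem (Set.mem_Ioi.2 hq), ENNReal.ofReal_mul (by positivity)]
          ring
        · have : expSphereIntegral A (((n : ℝ) + 1) / 2 - 1) q = 0 := by
            refine (lintegral_congr fun x => ?_).trans lintegral_zero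
            rw [if_neg (by nlinarith [sq_nonneg x, not_lt.1 hq]), mul_zero]
          rw [this, Set.indicator_of_notMem (by simpa using hq)]
          simp
    _ = _ := by
        rw [lintegral_const_mul' _ _ ENNReal.ofReal_ne_top, lintegral_indicator measurableSet_Ioi,
          ← mul_assoc, ENNReal.ofReal_mul ENNReal.toReal_nonneg, ENNReal.ofReal_toReal hCt]

lemma exists_noncentralChiSq_bounds (n : ℕ) (hn : 1 ≤ n) :
    ∃ c C : ℝ, 0 < c ∧ 0 < C ∧ ∀ A : ℝ, 0 < A → ∀ s : Set ℝ, MeasurableSet s →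
      (noncentralChiSq n A s ≤ ENNReal.ofReal C * ∫⁻ q in s ∩ Set.Ioi 0,
        ENNReal.ofReal (noncentralKernel A (((n : ℝ) + 1) / 2 - 1) q)) ∧
      ((∀ q ∈ s, 1 / 2 ≤ A * √q) → ENNReal.ofReal c * ∫⁻ q in s ∩ Set.Ioi 0,
        ENNReal.ofReal (noncentralKernel A (((n : ℝ) + 1) / 2 - 1) q) ≤ noncentralChiSq n A s) := by
  obtain ⟨C, hC0, hC⟩ := exists_lintegral_noncentralChiSq n
  set m := ((n : ℝ) + 1) / 2 - 1 with hm
  have hm0 : 0 ≤ m := by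
    have : (1 : ℝ) ≤ n := by exact_mod_cast hn
    linarith
  have hG : 0 < Real.Gamma (m + 1) := Real.Gamma_pos_of_pos (by linarith)
  have hker : ∀ A q K : ℝ, Real.exp (-(A ^ 2 + q) / 2) *
      (K * (A ^ (-(m + 1)) * Real.exp (A * √q) * q ^ (m / 2))) = K * noncentralKernel A m q := by
    intro A q K
    rw [noncentralKernel, Real.exp_add]; ring
  refine ⟨C * ((1 / 4) ^ (m + 1) * Real.exp (-1 / 2)), C * (2 ^ m * Real.Gamma (m + 1)),
    by positivity, by positivity, fun A hA s hs => ?_⟩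
  have hform : noncentralChiSq n A s = ENNReal.ofReal C * ∫⁻ q in s ∩ Set.Ioi 0,
      ENNReal.ofReal (Real.exp (-(A ^ 2 + q) / 2)) * expSphereIntegral A m q := by
    rw [← lintegral_indicator_one hs, hC A _ (measurable_one.indicator hs),
      ← Measure.restrict_restrict hs, ← lintegral_indicator hs]
    congr 1
    refine lintegral_congr fun q => ?_
    by_cases hq : q ∈ s <;> simp [hq]
  rw [hform]
  constructor
  · rw [ENNReal.ofReal_mul hC0.le, mul_assoc]
    refine mul_le_mul_right ?_ _
    rw [← lintegral_const_mul' _ _ ENNReal.ofReal_ne_top]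
    refine setLIntegral_mono' (hs.inter measurableSet_Ioi) fun q hq => ?_
    refine (mul_le_mul_right (expSphereIntegral_le hA hm0 hq.2) _).trans_eq ?_
    rw [← ENNReal.ofReal_mul (by positivity), ← ENNReal.ofReal_mul (by positivity), hker]
  · intro hs2
    rw [ENNReal.ofReal_mul hC0.le, mul_assoc]
    refine mul_le_mul_right ?_ _
    rw [← lintegral_const_mul' _ _ ENNReal.ofReal_ne_top]
    refine setLIntegral_mono' (hs.inter measurableSet_Ioi) fun q hq => ?_
    refine Eq.trans_le ?_ (mul_le_mul_right (le_expSphereIntegral hA hm0 (hs2 q hq.1)) _)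
    rw [← ENNReal.ofReal_mul (by positivity), ← ENNReal.ofReal_mul (by positivity), hker]

/-! ### Tail of the noncentral chi-square law -/

/-- Here `v` is the excess over the cut-off `r² - u`. The linear bound for `√q` together with `2A ≤
r` costs `exp (v / 4)`, and the power of `q` costs another `exp (v / 8)`; against `exp (-v / 2)` an
integrable `exp (-v / 8)` remains. -/
lemma noncentralKernel_le {A m r u v : ℝ} (hA : 0 < A) (hm : 0 ≤ m) (hr : 1 ≤ r)
    (hAr : 2 * A ≤ r) (hu : 0 ≤ u) (hv : 0 < v) (hq : 0 < v + (r ^ 2 - u)) :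
    noncentralKernel A m (v + (r ^ 2 - u)) ≤ (4 * m + 1) ^ (m / 2) * Real.exp (u / 2) *
      (A ^ (-(m + 1)) * r ^ m * Real.exp (-(r - A) ^ 2 / 2)) * Real.exp (-(1 / 8 * v)) := by
  have hr0 : 0 < r := by linarith
  set q := v + (r ^ 2 - u) with hqdef
  have hsqrt : √q ≤ r + v / (2 * r) := by
    rw [Real.sqrt_le_left (by positivity)]
    have : (r + v / (2 * r)) ^ 2 = r ^ 2 + v + (v / (2 * r)) ^ 2 := by field_simp; ring
    nlinarith [sq_nonneg (v / (2 * r))]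
  have hAs : A * √q ≤ A * r + v / 4 := by
    have h1 := mul_le_mul_of_nonneg_left hsqrt hA.le
    have h2 : A * (v / (2 * r)) ≤ v / 4 := by
      rw [mul_div_assoc', div_le_iff₀ (by positivity)]
      nlinarith
    linarith
  -- The scale `4m + 1` is chosen so that raising to the power `m / 2` leaves an exponent `v m / (2
  -- (4m + 1)) ≤ v / 8`; the added `1` keeps it positive at `m = 0`.
  have hN : 1 + v ≤ (4 * m + 1) * Real.exp (v / (4 * m + 1)) := by
    have h1 := Real.add_one_le_exp (v / (4 * m + 1))
    have h2 := mul_le_mul_of_nonneg_left h1 (by linarith : 0 ≤ 4 * m + 1)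
    have h3 : (4 * m + 1) * (v / (4 * m + 1) + 1) = v + (4 * m + 1) := by field_simp
    linarith
  have hpow : q ^ (m / 2) ≤ r ^ m * ((4 * m + 1) ^ (m / 2) * Real.exp (v / 8)) := by
    have hle : q ≤ r ^ 2 * (1 + v) := by
      have : 1 ≤ r ^ 2 := one_le_pow₀ hr
      nlinarith [mul_nonneg hv.le (sub_nonneg.2 this)]
    calc q ^ (m / 2) ≤ (r ^ 2 * ((4 * m + 1) * Real.exp (v / (4 * m + 1)))) ^ (m / 2) := by
          apply Real.rpow_le_rpow hq.le _ (by linarith)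
          exact hle.trans (by gcongr)
      _ = r ^ m * ((4 * m + 1) ^ (m / 2) * Real.exp (v / (4 * m + 1) * (m / 2))) := by
          rw [Real.mul_rpow (by positivity) (by positivity),
            Real.mul_rpow (by positivity) (by positivity), ← Real.exp_mul,
            ← Real.rpow_natCast r 2, ← Real.rpow_mul hr0.le]
          congr 2
          push_cast
          ring
      _ ≤ _ := by
          gcongr
          rw [div_mul_eq_mul_div, div_le_iff₀ (by linarith)]
          nlinarith
  calc noncentralKernel A m q ≤ A ^ (-(m + 1)) *
        Real.exp (-(A ^ 2 + q) / 2 + (A * r + v / 4)) *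
        (r ^ m * ((4 * m + 1) ^ (m / 2) * Real.exp (v / 8))) := by
        unfold noncentralKernel
        gcongr
    _ = _ := by
        have : Real.exp (-(A ^ 2 + q) / 2 + (A * r + v / 4)) * Real.exp (v / 8) =
            Real.exp (u / 2) * Real.exp (-(r - A) ^ 2 / 2) * Real.exp (-(1 / 8 * v)) := by
          rw [← Real.exp_add, ← Real.exp_add, ← Real.exp_add, hqdef]; congr 1; ring
        linear_combination (A ^ (-(m + 1)) * r ^ m * (4 * m + 1) ^ (m / 2)) * this

lemma le_noncentralKernel {A m r u v B : ℝ} (hA : 0 < A) (hm : 0 ≤ m) (hr : 0 < r)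
    (hu : 0 ≤ u) (hur : u ≤ r ^ 2 / 2) (hAu : A * u ≤ B * r) (hv : 0 ≤ v) (hv1 : v ≤ 1) :
    (1 / 2) ^ (m / 2) * Real.exp (-1 / 2 - B) * (Real.exp (u / 2) *
      (A ^ (-(m + 1)) * r ^ m * Real.exp (-(r - A) ^ 2 / 2))) ≤
      noncentralKernel A m (v + (r ^ 2 - u)) := by
  set q := v + (r ^ 2 - u) with hqdef
  -- Squaring gives `r² - 2u + u² / r²`, which is at most `r² - u` because `u ≤ r²`. The condition
  -- `A u ≤ B r` then bounds the loss in `A √q` by `B`.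
  have hsqrt : r - u / r ≤ √q := by
    refine Real.le_sqrt_of_sq_le ?_
    have h1 : (r - u / r) ^ 2 = r ^ 2 - 2 * u + u * (u / r ^ 2) := by field_simp; ring
    have h2 : u / r ^ 2 ≤ 1 := by
      rw [div_le_one (by positivity)]; nlinarith
    nlinarith
  have hAs : A * r - B ≤ A * √q := by
    have h1 := mul_le_mul_of_nonneg_left hsqrt hA.le
    have h2 : A * (u / r) ≤ B := by
      rw [mul_div_assoc', div_le_iff₀ hr]
      linarith
    linarith
  have hpow : r ^ m * (1 / 2) ^ (m / 2) ≤ q ^ (m / 2) := by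
    have : r ^ m = (r ^ 2) ^ (m / 2) := by
      rw [← Real.rpow_natCast r 2, ← Real.rpow_mul hr.le]
      congr 1; push_cast; ring
    rw [this, ← Real.mul_rpow (by positivity) (by norm_num)]
    apply Real.rpow_le_rpow (by positivity) _ (by linarith)
    linarith
  have hq1 : q ≤ 1 + (r ^ 2 - u) := by linarith
  calc _ = A ^ (-(m + 1)) * Real.exp (-(A ^ 2 + (1 + (r ^ 2 - u))) / 2 + (A * r - B)) *
        (r ^ m * (1 / 2) ^ (m / 2)) := by
        have : Real.exp (-(A ^ 2 + (1 + (r ^ 2 - u))) / 2 + (A * r - B)) =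
            Real.exp (u / 2) * Real.exp (-(r - A) ^ 2 / 2) * Real.exp (-1 / 2 - B) := by
          rw [← Real.exp_add, ← Real.exp_add]; congr 1; ring
        rw [this]; ring
    _ ≤ _ := by
        unfold noncentralKernel
        gcongr

lemma lintegral_exp_neg_div_eight :
    ∫⁻ v in Set.Ioi (0 : ℝ), ENNReal.ofReal (Real.exp (-(1 / 8 * v))) = ENNReal.ofReal 8 := by
  have h := lintegral_gammaPDF_eq_one (a := 1) (r := 1 / 8) one_pos (by norm_num)
  rw [← mul_one (ENNReal.ofReal 8), ← h, ← lintegral_const_mul' _ _ ENNReal.ofReal_ne_top,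
    ← lintegral_indicator measurableSet_Ioi]
  refine lintegral_congr_ae ?_
  filter_upwards [compl_mem_ae_iff.2 (measure_singleton (0 : ℝ))] with v hv
  rcases lt_or_gt_of_ne (Set.mem_compl_singleton_iff.1 hv) with h0 | h0
  · rw [Set.indicator_of_notMem (by simpa using h0.le), gammaPDF_of_neg h0, mul_zero]
  · rw [Set.indicator_of_mem (Set.mem_Ioi.2 h0), gammaPDF_of_nonneg h0.le,
      ← ENNReal.ofReal_mul (by norm_num)]
    simp

lemma exists_noncentralChiSq_tail_bounds (n : ℕ) (hn : 1 ≤ n) (B : ℝ) :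
    ∃ c C : ℝ, 0 < c ∧ 0 < C ∧ ∀ A r u : ℝ, 0 < A → 1 ≤ r → 2 * A ≤ r → 1 ≤ A * r → 0 ≤ u →
      (noncentralChiSq n A {q | r ^ 2 < q + u} ≤ ENNReal.ofReal (C * (A ^ (-(((n : ℝ) + 1) / 2)) *
        r ^ (((n : ℝ) + 1) / 2 - 1) * Real.exp (-(r - A) ^ 2 / 2))) *
          ENNReal.ofReal (Real.exp (u / 2))) ∧
      (u ≤ r ^ 2 / 2 → A * u ≤ B * r →
        ENNReal.ofReal (c * (A ^ (-(((n : ℝ) + 1) / 2)) *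
        r ^ (((n : ℝ) + 1) / 2 - 1) * Real.exp (-(r - A) ^ 2 / 2))) *
          ENNReal.ofReal (Real.exp (u / 2)) ≤ noncentralChiSq n A {q | r ^ 2 < q + u}) := by
  obtain ⟨c, C, hc, hC, h⟩ := exists_noncentralChiSq_bounds n hn
  set m := ((n : ℝ) + 1) / 2 - 1 with hm
  have hm0 : 0 ≤ m := by
    have : (1 : ℝ) ≤ n := by exact_mod_cast hn
    linarith
  have hm1 : ((n : ℝ) + 1) / 2 = m + 1 := by rw [hm]; ring
  refine ⟨c * ((1 / 2) ^ (m / 2) * Real.exp (-1 / 2 - B)), C * ((4 * m + 1) ^ (m / 2) * 8),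
    by positivity, by positivity, fun A r u hA hr hAr hAr1 hu => ?_⟩
  have hr0 : 0 < r := by linarith
  rw [hm1]
  set K := A ^ (-(m + 1)) * r ^ m * Real.exp (-(r - A) ^ 2 / 2) with hK
  have hK0 : 0 < K := by positivity
  have hmeas : MeasurableSet {q : ℝ | r ^ 2 < q + u} :=
    measurableSet_lt measurable_const (by fun_prop)
  constructor
  · refine (h A hA _ hmeas).1.trans ?_
    rw [← lintegral_indicator (hmeas.inter measurableSet_Ioi),
      ← lintegral_add_right_eq_self _ (r ^ 2 - u)]
    calc _ ≤ ENNReal.ofReal C * ∫⁻ v in Set.Ioi (0 : ℝ),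
          ENNReal.ofReal ((4 * m + 1) ^ (m / 2) * Real.exp (u / 2) * K) *
            ENNReal.ofReal (Real.exp (-(1 / 8 * v))) := by
          rw [← lintegral_indicator measurableSet_Ioi]
          gcongr with v
          by_cases hv : v + (r ^ 2 - u) ∈ {q : ℝ | r ^ 2 < q + u} ∩ Set.Ioi 0
          · have hv0 : 0 < v := by
              have := hv.1
              simp only [Set.mem_ofPred_eq] at this
              linarith
            rw [Set.indicator_of_mem hv, Set.indicator_of_mem (Set.mem_Ioi.2 hv0),
              ← ENNReal.ofReal_mul (by positivity)]
            exact ENNReal.ofReal_le_ofReal (noncentralKernel_le hA hm0 hr hAr hu hv0 hv.2)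
          · rw [Set.indicator_of_notMem hv]
            exact zero_le
      _ = _ := by
          rw [lintegral_const_mul' _ _ ENNReal.ofReal_ne_top, lintegral_exp_neg_div_eight,
            ← ENNReal.ofReal_mul (by positivity), ← ENNReal.ofReal_mul (by positivity),
            ← ENNReal.ofReal_mul (by positivity)]
          congr 1; ring
  · intro hur hAu
    -- For the lower bound, a unit interval just above the cut-off already has mass of the right
    -- order.
    have hsub : Set.Ioc (0 + (r ^ 2 - u)) (1 + (r ^ 2 - u)) ⊆ {q : ℝ | r ^ 2 < q + u} := by
      intro q hq
      have := hq.1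
      simp only [Set.mem_ofPred_eq]
      linarith
    refine le_trans ?_ (measure_mono hsub)
    refine le_trans ?_ ((h A hA _ measurableSet_Ioc).2 fun q hq => ?_)
    · have hsub2 : Set.Ioc (0 + (r ^ 2 - u)) (1 + (r ^ 2 - u)) ∩ Set.Ioi 0 =
          Set.Ioc (0 + (r ^ 2 - u)) (1 + (r ^ 2 - u)) := by
        refine Set.inter_eq_left.2 fun q hq => ?_
        have := hq.1
        have h2 : 0 < r ^ 2 := by positivity
        exact Set.mem_Ioi.2 (by linarith)
      rw [hsub2]
      calc _ = ENNReal.ofReal c * ∫⁻ q in Set.Ioc (0 + (r ^ 2 - u)) (1 + (r ^ 2 - u)),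
            ENNReal.ofReal ((1 / 2) ^ (m / 2) * Real.exp (-1 / 2 - B) *
              (Real.exp (u / 2) * K)) := by
            rw [setLIntegral_const, Real.volume_Ioc, ← ENNReal.ofReal_mul (by positivity),
              ← ENNReal.ofReal_mul (by positivity), ← ENNReal.ofReal_mul (by positivity)]
            congr 1; ring
        _ ≤ _ := by
            gcongr _ * ?_
            refine setLIntegral_mono' measurableSet_Ioc fun q hq => ENNReal.ofReal_le_ofReal ?_
            have := le_noncentralKernel (v := q - (r ^ 2 - u)) hA hm0 hr0 hu hur hAu
              (by linarith [hq.1]) (by linarith [hq.2])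
            rwa [sub_add_cancel q] at this
    · have h1 : r / 2 ≤ √q := by
        refine Real.le_sqrt_of_sq_le ?_
        have := hq.1
        nlinarith
      nlinarith

/-! ### Exponential tilting of one-dimensional Gaussians -/

/-- Completing the square: for `v < 1`, weighting by `exp (z² / 2)` keeps the law Gaussian and
divides both mean and variance by `1 - v`. -/
lemma gaussianPDFReal_mul_exp_sq (b : ℝ) {v : NNReal} (hv : v < 1) (hv0 : v ≠ 0) (z : ℝ) :
    gaussianPDFReal b v z * Real.exp (z ^ 2 / 2) =
      (√(1 - v))⁻¹ * Real.exp (b ^ 2 / (2 * (1 - v))) *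
        gaussianPDFReal (b / (1 - v)) (v / (1 - v)) z := by
  have h1 : 0 < 1 - (v : ℝ) := sub_pos.2 (by exact_mod_cast hv)
  have h0 : 0 < (v : ℝ) := by positivity
  have hc : ((v / (1 - v) : NNReal) : ℝ) = v / (1 - v) := by
    rw [NNReal.coe_div, NNReal.coe_sub hv.le, NNReal.coe_one]
  rw [gaussianPDFReal, gaussianPDFReal, hc]
  have e1 : √(2 * Real.pi * v) = √(1 - v) * √(2 * Real.pi * (v / (1 - v))) := by
    rw [← Real.sqrt_mul h1.le]; congr 1; field_simp
  have e2 : Real.exp (-(z - b) ^ 2 / (2 * v)) * Real.exp (z ^ 2 / 2) =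
      Real.exp (b ^ 2 / (2 * (1 - v))) *
        Real.exp (-(z - b / (1 - v)) ^ 2 / (2 * (v / (1 - v)))) := by
    rw [← Real.exp_add, ← Real.exp_add]; congr 1; field_simp; ring
  rw [mul_assoc, e2, e1, mul_inv]
  ring

lemma lintegral_mul_exp_sq_gaussianReal (b : ℝ) {v : NNReal} (hv : v < 1) {f : ℝ → ℝ≥0∞}
    (hf : Measurable f) :
    ∫⁻ z, f z * ENNReal.ofReal (Real.exp (z ^ 2 / 2)) ∂gaussianReal b v =
      ENNReal.ofReal ((√(1 - v))⁻¹ * Real.exp (b ^ 2 / (2 * (1 - v)))) *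
        ∫⁻ z, f z ∂gaussianReal (b / (1 - v)) (v / (1 - v)) := by
  -- Variance zero is a point mass without density, so it is treated directly; it occurs when an
  -- eigenvalue vanishes.
  rcases eq_or_ne v 0 with rfl | hv0
  · simp [gaussianReal_zero_var, lintegral_dirac, mul_comm]
  · have hv1 : v / (1 - v) ≠ 0 := div_ne_zero hv0 (tsub_pos_of_lt hv).ne'
    rw [gaussianReal_of_var_ne_zero _ hv0, gaussianReal_of_var_ne_zero _ hv1,
      lintegral_withDensity_eq_lintegral_mul _ (measurable_gaussianPDF _ _) (by fun_prop),
      lintegral_withDensity_eq_lintegral_mul _ (measurable_gaussianPDF _ _) hf,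
      ← lintegral_const_mul' _ _ ENNReal.ofReal_ne_top]
    refine lintegral_congr fun z => ?_
    simp only [Pi.mul_apply]
    rw [mul_comm (f z), ← mul_assoc, ← mul_assoc, gaussianPDF, gaussianPDF,
      ← ENNReal.ofReal_mul (gaussianPDFReal_nonneg _ _ _), gaussianPDFReal_mul_exp_sq b hv hv0,
      ← ENNReal.ofReal_mul (by positivity)]

lemma lintegral_ofReal_sq_gaussianReal (b : ℝ) (v : NNReal) :
    ∫⁻ z, ENNReal.ofReal (z ^ 2) ∂gaussianReal b v = ENNReal.ofReal (v + b ^ 2) := by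
  have h2 : MemLp (fun x : ℝ => x) 2 (gaussianReal b v) := memLp_id_gaussianReal' 2 (by simp)
  have h := variance_eq_sub h2
  rw [variance_fun_id_gaussianReal, integral_id_gaussianReal] at h
  rw [← ofReal_integral_eq_lintegral_ofReal h2.integrable_sq
    (Filter.Eventually.of_forall fun z => sq_nonneg z)]
  congr 1
  have e : ∫ x, ((fun x : ℝ => x) ^ 2) x ∂gaussianReal b v = ∫ x, x ^ 2 ∂gaussianReal b v := rfl
  rw [e] at h
  linarith

lemma lintegral_exp_sq_gaussianReal (b : ℝ) {v : NNReal} (hv : v < 1) :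
    ∫⁻ z, ENNReal.ofReal (Real.exp (z ^ 2 / 2)) ∂gaussianReal b v =
      ENNReal.ofReal ((√(1 - v))⁻¹ * Real.exp (b ^ 2 / (2 * (1 - v)))) := by
  simpa using lintegral_mul_exp_sq_gaussianReal b hv (f := fun _ => 1) measurable_const

/-- Bounding by the exponential of a multiple of the second moment lets a product over coordinates
become a sum of second moments. The normalizing factor is handled by `(1 - v)⁻¹ = 1 + v / (1 - v) ≤
exp (v / (1 - v))`. -/
lemma lintegral_exp_sq_gaussianReal_le (b κ : ℝ) {v : NNReal} (hv : v < 1)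
    (hκ : (1 - (v : ℝ))⁻¹ ≤ κ) :
    ∫⁻ z, ENNReal.ofReal (Real.exp (z ^ 2 / 2)) ∂gaussianReal b v ≤
      ENNReal.ofReal (Real.exp (κ / 2 * (v + b ^ 2))) := by
  have h1 : 0 < 1 - (v : ℝ) := sub_pos.2 (by exact_mod_cast hv)
  rw [lintegral_exp_sq_gaussianReal b hv]
  refine ENNReal.ofReal_le_ofReal ?_
  have e1 : (√(1 - v))⁻¹ ≤ Real.exp (κ / 2 * v) := by
    rw [← Real.sqrt_inv, Real.sqrt_le_left (Real.exp_pos _).le, ← Real.exp_nat_mul]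
    have h2 : (1 - (v : ℝ))⁻¹ = (1 - (v : ℝ))⁻¹ * v + 1 := by field_simp; ring
    rw [h2]
    refine (Real.add_one_le_exp _).trans (Real.exp_le_exp.2 ?_)
    push_cast
    nlinarith [v.coe_nonneg, mul_le_mul_of_nonneg_right hκ v.coe_nonneg]
  have e2 : b ^ 2 / (2 * (1 - v)) ≤ κ / 2 * b ^ 2 := by
    have : b ^ 2 / (2 * (1 - v)) = (1 - (v : ℝ))⁻¹ / 2 * b ^ 2 := by field_simp
    rw [this]
    gcongr
  rw [mul_add, Real.exp_add]
  gcongr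

/-- The tilted second moment is `v / (1 - v) + b² / (1 - v)²`; since `κ ≥ 1`, both terms are covered
by the factor `κ²`. -/
lemma lintegral_sq_mul_exp_sq_gaussianReal_le (b κ : ℝ) {v : NNReal} (hv : v < 1)
    (hκ : (1 - (v : ℝ))⁻¹ ≤ κ) :
    ∫⁻ z, ENNReal.ofReal (z ^ 2) * ENNReal.ofReal (Real.exp (z ^ 2 / 2)) ∂gaussianReal b v ≤
      ENNReal.ofReal (κ ^ 2) * (∫⁻ z, ENNReal.ofReal (z ^ 2) ∂gaussianReal b v) *
        ∫⁻ z, ENNReal.ofReal (Real.exp (z ^ 2 / 2)) ∂gaussianReal b v := by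
  have h1 : 0 < 1 - (v : ℝ) := sub_pos.2 (by exact_mod_cast hv)
  have h2 : 1 ≤ (1 - (v : ℝ))⁻¹ := by
    rw [one_le_inv₀ h1]
    linarith [v.coe_nonneg]
  rw [lintegral_mul_exp_sq_gaussianReal b hv (by fun_prop), lintegral_exp_sq_gaussianReal b hv,
    lintegral_ofReal_sq_gaussianReal, lintegral_ofReal_sq_gaussianReal, mul_comm]
  gcongr ?_ * _
  rw [← ENNReal.ofReal_mul (sq_nonneg κ)]
  refine ENNReal.ofReal_le_ofReal ?_
  have hc : ((v / (1 - v) : NNReal) : ℝ) = (1 - (v : ℝ))⁻¹ * v := by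
    rw [NNReal.coe_div, NNReal.coe_sub hv.le, NNReal.coe_one, div_eq_inv_mul]
  have h3 : (1 - (v : ℝ))⁻¹ ^ 2 ≤ κ ^ 2 := by gcongr
  have h4 : (1 - (v : ℝ))⁻¹ ≤ κ ^ 2 := by nlinarith
  rw [hc, div_eq_inv_mul, mul_pow, mul_add]
  gcongr

/-! ### Coordinates, remainder and independence in Hilbert space -/

section

variable {ι H : Type*} [NormedAddCommGroup H] [InnerProductSpace ℝ H]

lemma countable_of_hilbertBasis [SecondCountableTopology H] (e : HilbertBasis ι ℝ H) :
    Countable ι := by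
  refine Pairwise.countable_of_isOpen_disjoint (s := fun i => Metric.ball (e i) (1 / 2)) ?_
    (fun i => Metric.isOpen_ball) (fun i => Metric.nonempty_ball.2 (by norm_num))
  intro i j hij
  refine Metric.ball_disjoint_ball ?_
  have h1 : ‖e i - e j‖ ^ 2 = 2 := by
    rw [norm_sub_sq_real, e.orthonormal.2 hij, e.orthonormal.1, e.orthonormal.1]; norm_num
  rw [dist_eq_norm]
  nlinarith [norm_nonneg (e i - e j)]

lemma hasSum_sq_inner (e : HilbertBasis ι ℝ H) (x : H) :
    HasSum (fun j => ⟪x, e j⟫ ^ 2) (‖x‖ ^ 2) := by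
  have h := e.hasSum_inner_mul_inner x x
  rw [real_inner_self_eq_norm_sq] at h
  refine h.congr_fun fun j => ?_
  rw [real_inner_comm, sq, real_inner_comm]

lemma hasSum_remainder (e : HilbertBasis ι ℝ H) (S : Finset ι) (a y : H) :
    HasSum (fun j : {j : ι // j ∉ S} => (⟪y, e j⟫ - ⟪a, e j⟫) ^ 2)
      (‖y - a‖ ^ 2 - ∑ j ∈ S, ⟪y - a, e j⟫ ^ 2) := by
  have h : HasSum (fun j : {j : ι // j ∉ S} => ⟪y - a, e j⟫ ^ 2)
      (‖y - a‖ ^ 2 - ∑ j ∈ S, ⟪y - a, e j⟫ ^ 2) :=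
    (S.hasSum_compl_iff (f := fun j => ⟪y - a, e j⟫ ^ 2)).2
      (by simpa using hasSum_sq_inner e (y - a))
  simpa only [inner_sub_left] using h

/-- Replaces the infinite series by a norm and a finite sum, from which continuity, measurability
and integrability are immediate. -/
lemma remainder_eq (e : HilbertBasis ι ℝ H) (S : Finset ι) (a y : H) :
    remainder e S a y = ‖y - a‖ ^ 2 - ∑ j ∈ S, ⟪y - a, e j⟫ ^ 2 :=
  (hasSum_remainder e S a y).tsum_eq

lemma remainder_nonneg (e : HilbertBasis ι ℝ H) (S : Finset ι) (a y : H) :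
    0 ≤ remainder e S a y :=
  tsum_nonneg fun _ => sq_nonneg _

lemma remainder_le (e : HilbertBasis ι ℝ H) (S : Finset ι) (a y : H) :
    remainder e S a y ≤ ‖y - a‖ ^ 2 := by
  rw [remainder_eq]
  linarith [Finset.sum_nonneg fun j (_ : j ∈ S) => sq_nonneg ⟪y - a, e j⟫]

lemma continuous_remainder (e : HilbertBasis ι ℝ H) (S : Finset ι) (a : H) :
    Continuous (remainder e S a) := by
  have : remainder e S a = fun y => ‖y - a‖ ^ 2 - ∑ j ∈ S, ⟪y - a, e j⟫ ^ 2 :=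
    funext (remainder_eq e S a)
  rw [this]
  fun_prop

lemma remainder_insert [DecidableEq ι] (e : HilbertBasis ι ℝ H) {S : Finset ι} {j : ι} (hj : j ∉ S)
    (a y : H) :
    remainder e S a y = (⟪y, e j⟫ - ⟪a, e j⟫) ^ 2 + remainder e (insert j S) a y := by
  rw [remainder_eq, remainder_eq, Finset.sum_insert hj, ← inner_sub_left]
  ring

/-- The projection along the basis vectors in `S`. -/
noncomputable def residual (e : HilbertBasis ι ℝ H) (S : Finset ι) : H →L[ℝ] H :=
  ContinuousLinearMap.id ℝ H - ∑ j ∈ S, (innerSL ℝ (e j)).smulRight (e j)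

lemma residual_apply (e : HilbertBasis ι ℝ H) (S : Finset ι) (y : H) :
    residual e S y = y - ∑ j ∈ S, ⟪e j, y⟫ • e j := by
  simp [residual]

lemma residual_basis (e : HilbertBasis ι ℝ H) {S : Finset ι} {j : ι} (hj : j ∈ S) :
    residual e S (e j) = 0 := by
  classical
  rw [residual_apply, Finset.sum_eq_single_of_mem j hj]
  · rw [real_inner_self_eq_norm_sq, e.orthonormal.1]; simp
  · intro i _ hij
    rw [e.orthonormal.2 hij, zero_smul]

lemma inner_residual (e : HilbertBasis ι ℝ H) {S : Finset ι} {j : ι} (hj : j ∉ S) (y : H) :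
    ⟪residual e S y, e j⟫ = ⟪y, e j⟫ := by
  rw [residual_apply, inner_sub_left, sum_inner, Finset.sum_eq_zero, sub_zero]
  intro i hi
  have hij : i ≠ j := fun h => hj (h ▸ hi)
  rw [inner_smul_left, e.orthonormal.2 hij, mul_zero]

lemma remainder_residual (e : HilbertBasis ι ℝ H) (S : Finset ι) (a y : H) :
    remainder e S a (residual e S y) = remainder e S a y := by
  unfold remainder
  refine tsum_congr fun j => ?_
  rw [inner_residual e j.2]

variable [MeasurableSpace H] [BorelSpace H] {μ : Measure H} [IsGaussian μ]

lemma hasGaussianLaw_clm {F : Type*} [NormedAddCommGroup F] [NormedSpace ℝ F] [MeasurableSpace F]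
    [BorelSpace F] (L : H →L[ℝ] F) : HasGaussianLaw (fun z => L z) μ :=
  (IsGaussian.hasGaussianLaw_id (μ := μ)).map_fun L

variable [CompleteSpace H] [SecondCountableTopology H]

lemma integral_inner_eq_zero (h0 : ∫ z, z ∂μ = 0) (x : H) : ∫ z, ⟪x, z⟫ ∂μ = 0 := by
  have h := integral_inner (𝕜 := ℝ) (IsGaussian.integrable_id (μ := μ)) x
  simpa [h0] using h

lemma covariance_inner_inner (h0 : ∫ z, z ∂μ = 0) (x y : H) :
    cov[fun z => ⟪x, z⟫, fun z => ⟪y, z⟫; μ] = ⟪covarianceOperator μ x, y⟫ := by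
  rw [covarianceOperator_inner IsGaussian.memLp_two_id, covariance,
    integral_inner_eq_zero h0, integral_inner_eq_zero h0]
  simp

lemma map_inner_sub_eq_gaussianReal (h0 : ∫ z, z ∂μ = 0) (x : H) (b : ℝ) :
    μ.map (fun z => ⟪x, z⟫ - b) =
      gaussianReal (-b) (⟪covarianceOperator μ x, x⟫).toNNReal := by
  have h1 : μ.map (fun z => ⟪x, z⟫) = gaussianReal 0 (⟪covarianceOperator μ x, x⟫).toNNReal := by
    have h := (hasGaussianLaw_clm (μ := μ) (innerSL ℝ x)).map_eq_gaussianReal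
    simp only [innerSL_apply_apply] at h
    rw [h, integral_inner_eq_zero h0, ← covariance_self (by fun_prop),
      covariance_inner_inner h0]
  have h2 : (fun z => ⟪x, z⟫ - b) = (fun t => t - b) ∘ fun z => ⟪x, z⟫ := rfl
  rw [h2, ← Measure.map_map (by fun_prop) (by fun_prop), h1, gaussianReal_map_sub_const, zero_sub]

lemma iIndepFun_inner {κ : Type*} [Finite κ] (h0 : ∫ z, z ∂μ = 0) (x : κ → H)
    (hx : ∀ i j, i ≠ j → ⟪covarianceOperator μ (x i), x j⟫ = 0) :
    iIndepFun (fun i z => ⟪x i, z⟫) μ := by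
  have := Fintype.ofFinite κ
  refine HasGaussianLaw.iIndepFun_of_covariance_eq_zero
    (hasGaussianLaw_clm (ContinuousLinearMap.pi fun i => innerSL ℝ (x i))) fun i j hij => ?_
  rw [covariance_inner_inner h0, hx i j hij]

/-- The remainder factors through `residual e S`, which is jointly Gaussian with the functionals `⟪x
i, ·⟫`, so vanishing covariances suffice. By Riesz, a functional of the residual is represented by
some `q`; it is orthogonal to every `e j`, `j ∈ S`, because the residual kills these vectors, and
`hx` applies to `q`. -/
lemma indepFun_inner_remainder {κ : Type*} [Finite κ] (h0 : ∫ z, z ∂μ = 0)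
    (e : HilbertBasis ι ℝ H) (S : Finset ι) (a : H) (x : κ → H)
    (hx : ∀ i h, (∀ j ∈ S, ⟪h, e j⟫ = 0) → ⟪covarianceOperator μ (x i), h⟫ = 0) :
    IndepFun (fun z i => ⟪x i, z⟫) (remainder e S a) μ := by
  have := Fintype.ofFinite κ
  have hind : IndepFun (fun z i => ⟪x i, z⟫) (fun z => residual e S z) μ := by
    set X : H →L[ℝ] (κ → ℝ) := ContinuousLinearMap.pi fun i => innerSL ℝ (x i) with hX
    refine HasGaussianLaw.indepFun_of_covariance_strongDual
      (hasGaussianLaw_clm (X.prod (residual e S))) fun L₁ L₂ => ?_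
    set p := (InnerProductSpace.toDual ℝ H).symm (L₁ ∘L X) with hp
    set q := (InnerProductSpace.toDual ℝ H).symm (L₂ ∘L residual e S) with hq
    have hp' : ∀ z, ⟪p, z⟫ = L₁ (X z) := fun z => by simp [hp]
    have hq' : ∀ z, ⟪q, z⟫ = L₂ (residual e S z) := fun z => by simp [hq]
    have e1 : L₁ ∘ (fun z i => ⟪x i, z⟫) = fun z => ⟪p, z⟫ := by
      funext z; rw [hp']; rfl
    have e2 : L₂ ∘ (fun z => residual e S z) = fun z => ⟪q, z⟫ := by
      funext z; rw [hq']; rfl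
    have hsymm : ∀ u v, ⟪covarianceOperator μ u, v⟫ = ⟪covarianceOperator μ v, u⟫ := by
      intro u v
      rw [covarianceOperator_inner IsGaussian.memLp_two_id,
        covarianceOperator_inner IsGaussian.memLp_two_id]
      simp only [mul_comm]
    rw [e1, e2, covariance_inner_inner h0, hsymm, real_inner_comm, hp']
    have : X (covarianceOperator μ q) = 0 := by
      funext i
      change ⟪x i, covarianceOperator μ q⟫ = 0
      rw [real_inner_comm, hsymm]
      exact hx i q fun j hj => by rw [hq', residual_basis e hj, map_zero]
    rw [this, map_zero]
  have h := hind.comp (φ := id) (ψ := remainder e S a) measurable_id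
    (continuous_remainder e S a).measurable
  convert! h using 1
  funext z
  exact (remainder_residual e S a z).symm

end

/-! ### Markov's inequality for a weighted measure -/

lemma lintegral_le_two_mul_setLIntegral {α : Type*} [MeasurableSpace α] {μ : Measure α}
    {ρ : α → ℝ} (hρ : Measurable ρ) {E : α → ℝ≥0∞} (hE : Measurable E)
    (hEt : ∫⁻ x, E x ∂μ ≠ ⊤) {K U : ℝ} (hKU : 2 * K ≤ U) (hK : 0 ≤ K)
    (h : ∫⁻ x, ENNReal.ofReal (ρ x) * E x ∂μ ≤ ENNReal.ofReal K * ∫⁻ x, E x ∂μ) :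
    ∫⁻ x, E x ∂μ ≤ 2 * ∫⁻ x in {x | ρ x ≤ U}, E x ∂μ := by
  have hms : MeasurableSet {x | ρ x ≤ U} := measurableSet_le hρ measurable_const
  have hsplit := lintegral_add_compl E hms (μ := μ)
  set M := ∫⁻ x, E x ∂μ with hM
  set a := ∫⁻ x in {x | ρ x ≤ U}, E x ∂μ with ha
  set b := ∫⁻ x in {x | ρ x ≤ U}ᶜ, E x ∂μ with hb
  have hUb : ENNReal.ofReal U * b ≤ ENNReal.ofReal K * M := by
    refine le_trans ?_ h
    refine le_trans ?_ (setLIntegral_le_lintegral {x | ρ x ≤ U}ᶜ _)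
    rw [hb, ← lintegral_const_mul _ hE]
    refine setLIntegral_mono' hms.compl fun x hx => ?_
    have hx' : U ≤ ρ x := (not_le.1 (show ¬ρ x ≤ U from hx)).le
    gcongr
  -- When `K = 0` the level `U` may be zero and cannot be divided out; in that case the weight
  -- vanishes almost everywhere on `{ρ > U}`.
  rcases hK.eq_or_lt with hK0 | hKpos
  · have hz : ∫⁻ x, ENNReal.ofReal (ρ x) * E x ∂μ = 0 := by
      rw [← hK0] at h
      simpa using h
    rw [lintegral_eq_zero_iff (by fun_prop)] at hz
    have hb0 : b = 0 := by
      rw [hb, lintegral_eq_zero_iff hE]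
      refine (ae_restrict_iff' hms.compl).2 ?_
      filter_upwards [hz] with x hx hxs
      have hpos : 0 < ρ x := lt_of_le_of_lt (by linarith) (not_le.1 (show ¬ρ x ≤ U from hxs))
      rcases mul_eq_zero.1 hx with h1 | h1
      · rw [ENNReal.ofReal_eq_zero] at h1
        linarith
      · exact h1
    rw [← hsplit, hb0, add_zero, two_mul]
    exact le_self_add
  · have hU : 0 < U := by linarith
    have h2b : 2 * b ≤ M := by
      have h1 : ENNReal.ofReal U * (2 * b) ≤ ENNReal.ofReal U * M := by
        calc ENNReal.ofReal U * (2 * b) = 2 * (ENNReal.ofReal U * b) := by ring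
          _ ≤ 2 * (ENNReal.ofReal K * M) := by gcongr
          _ = ENNReal.ofReal (2 * K) * M := by
            rw [ENNReal.ofReal_mul (by norm_num)]; simp [mul_assoc]
          _ ≤ _ := by gcongr
      exact (ENNReal.mul_le_mul_iff_right (ENNReal.ofReal_pos.2 hU).ne' ENNReal.ofReal_ne_top).1 h1
    have h3 : M + M ≤ 2 * a + M := by
      calc M + M = 2 * a + 2 * b := by rw [← two_mul, ← hsplit, mul_add]
        _ ≤ _ := by gcongr
    exact (ENNReal.add_le_add_iff_right hEt).1 h3

/-! ### Exponential moment of the remainder -/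

section

variable {ι H : Type*} [NormedAddCommGroup H] [InnerProductSpace ℝ H]
  {e : HilbertBasis ι ℝ H} {σ : ι → ℝ} {σ₁ : ℝ} {S : Finset ι}

lemma IsEigenbasis.inner_apply {V : H →L[ℝ] H} (he : IsEigenbasis V e σ σ₁ S) (j : ι) (h : H) :
    ⟪V (e j), h⟫ = σ j ^ 2 * ⟪e j, h⟫ := by
  rw [he.eigen, real_inner_smul_left]

lemma IsEigenbasis.le_nextEigenvalue {V : H →L[ℝ] H} (he : IsEigenbasis V e σ σ₁ S) {j : ι}
    (hj : j ∉ S) : σ j ^ 2 ≤ nextEigenvalue σ S := by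
  refine le_ciSup (f := fun j : {j : ι // j ∉ S} => σ j ^ 2) ⟨σ₁ ^ 2, ?_⟩ ⟨j, hj⟩
  rintro _ ⟨i, rfl⟩
  have := he.nonneg i
  have := (he.lt_top i i.2).le
  simp only
  gcongr

lemma IsEigenbasis.toNNReal_lt_one {V : H →L[ℝ] H} (he : IsEigenbasis V e σ σ₁ S) {j : ι}
    (hj : j ∉ S) : (σ j ^ 2 / σ₁ ^ 2).toNNReal < 1 := by
  have h1 := he.lt_top j hj
  have h2 := he.nonneg j
  have h3 := he.pos
  rw [Real.toNNReal_lt_one, div_lt_one (by positivity)]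
  gcongr

lemma hasSum_remainder_div (e : HilbertBasis ι ℝ H) (S : Finset ι) (a z : H) (s : ℝ) :
    HasSum (fun j : {j : ι // j ∉ S} => ((⟪z, e j⟫ - ⟪a, e j⟫) / s) ^ 2)
      (remainder e S a z / s ^ 2) := by
  have h := (hasSum_remainder e S a z).div_const (s ^ 2)
  rw [← remainder_eq] at h
  simpa only [div_pow] using h

variable [CompleteSpace H] [SecondCountableTopology H] [MeasurableSpace H] [BorelSpace H]
  {μ : Measure H} [IsGaussian μ]

lemma IsEigenbasis.summable (he : IsEigenbasis (covarianceOperator μ) e σ σ₁ S) :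
    Summable fun j => σ j ^ 2 := by
  have hint : Integrable (fun z : H => ‖z‖ ^ 2) μ :=
    (IsGaussian.memLp_two_id (μ := μ)).integrable_norm_pow (by norm_num)
  refine summable_of_sum_le (c := ∫ z, ‖z‖ ^ 2 ∂μ) (fun j => sq_nonneg _) fun F => ?_
  have h1 : ∀ j, σ j ^ 2 = ∫ z, ⟪z, e j⟫ ^ 2 ∂μ := by
    intro j
    have h := he.inner_apply j (e j)
    rw [real_inner_self_eq_norm_sq, e.orthonormal.1, one_pow, mul_one,
      covarianceOperator_inner IsGaussian.memLp_two_id] at h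
    rw [← h]
    refine integral_congr_ae (Filter.Eventually.of_forall fun z => ?_)
    simp only
    rw [real_inner_comm, sq]
  have hint2 : ∀ j, Integrable (fun z => ⟪z, e j⟫ ^ 2) μ := by
    intro j
    refine hint.mono' (by fun_prop) (Filter.Eventually.of_forall fun z => ?_)
    rw [Real.norm_of_nonneg (sq_nonneg _), sq_le_sq, abs_norm]
    simpa [e.orthonormal.1] using abs_real_inner_le_norm z (e j)
  simp only [h1]
  rw [← integral_finsetSum _ fun j _ => hint2 j]
  refine integral_mono (integrable_finsetSum _ fun j _ => hint2 j) hint fun z => ?_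
  exact sum_le_hasSum F (fun _ _ => sq_nonneg _) (hasSum_sq_inner e z)

lemma IsEigenbasis.nextEigenvalue_lt (he : IsEigenbasis (covarianceOperator μ) e σ σ₁ S) :
    nextEigenvalue σ S < σ₁ ^ 2 := by
  have hpos := he.pos
  have hpos2 : 0 < σ₁ ^ 2 := by positivity
  have hfin : {j | ¬ σ j ^ 2 < σ₁ ^ 2 / 2}.Finite :=
    he.summable.tendsto_cofinite_zero.eventually (gt_mem_nhds (half_pos hpos2))
  -- Summability leaves finitely many eigenvalues at or above `σ₁² / 2`, so the strict gap survives
  -- the supremum. `B ≥ 0` covers an empty index set, whose supremum is `0`.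
  obtain ⟨B, hB, hB0, hle⟩ : ∃ B < σ₁ ^ 2, 0 ≤ B ∧ ∀ j, j ∉ S → σ j ^ 2 ≤ B := by
    rcases ({j | ¬ σ j ^ 2 < σ₁ ^ 2 / 2} ∩ {j | j ∉ S}).eq_empty_or_nonempty with h | h
    · refine ⟨σ₁ ^ 2 / 2, by linarith, by linarith, fun j hj => ?_⟩
      by_contra hlt
      have : j ∈ {j | ¬ σ j ^ 2 < σ₁ ^ 2 / 2} ∩ {j | j ∉ S} :=
        ⟨fun h => hlt h.le, hj⟩
      rw [h] at this
      exact this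
    · obtain ⟨i, hi, hmax⟩ := Set.exists_max_image _ (fun j => σ j ^ 2)
        (hfin.inter_of_left {j | j ∉ S}) h
      have h1 := he.lt_top i hi.2
      have h2 := he.nonneg i
      refine ⟨max (σ i ^ 2) (σ₁ ^ 2 / 2), max_lt (by gcongr) (by linarith),
        le_max_of_le_left (sq_nonneg _), fun j hj => ?_⟩
      by_cases hlt : σ j ^ 2 < σ₁ ^ 2 / 2
      · exact le_max_of_le_right hlt.le
      · exact le_max_of_le_left (hmax j ⟨hlt, hj⟩)
  exact (Real.iSup_le (fun j : {j : ι // j ∉ S} => hle j j.2) hB0).trans_lt hB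

/-- The law of a normalized coordinate of `z - a`. -/
lemma IsEigenbasis.map_coord (he : IsEigenbasis (covarianceOperator μ) e σ σ₁ S)
    (h0 : ∫ z, z ∂μ = 0) (a : H) (j : ι) :
    μ.map (fun z => (⟪z, e j⟫ - ⟪a, e j⟫) / σ₁) =
      gaussianReal (-(⟪a, e j⟫ / σ₁)) (σ j ^ 2 / σ₁ ^ 2).toNNReal := by
  have h := map_inner_sub_eq_gaussianReal h0 (σ₁⁻¹ • e j) (⟪a, e j⟫ / σ₁)
  have e1 : ⟪covarianceOperator μ (σ₁⁻¹ • e j), σ₁⁻¹ • e j⟫ = σ j ^ 2 / σ₁ ^ 2 := by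
    rw [map_smul, real_inner_smul_left, real_inner_smul_right, he.inner_apply,
      real_inner_self_eq_norm_sq, e.orthonormal.1]
    have := he.pos
    field_simp
  rw [e1] at h
  rw [← h]
  congr 1
  funext z
  rw [real_inner_smul_left, real_inner_comm]
  ring

lemma IsEigenbasis.inv_one_sub_le (he : IsEigenbasis (covarianceOperator μ) e σ σ₁ S) {j : ι}
    (hj : j ∉ S) : (1 - ((σ j ^ 2 / σ₁ ^ 2).toNNReal : ℝ))⁻¹ ≤
      (1 - nextEigenvalue σ S / σ₁ ^ 2)⁻¹ := by
  have hpos : 0 < σ₁ ^ 2 := pow_pos he.pos 2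
  have h1 := he.le_nextEigenvalue hj
  have h2 := he.nextEigenvalue_lt
  rw [Real.coe_toNNReal _ (by positivity)]
  have h3 : nextEigenvalue σ S / σ₁ ^ 2 < 1 := (div_lt_one hpos).2 h2
  gcongr

lemma integrable_remainder (e : HilbertBasis ι ℝ H) (S : Finset ι) (a : H) :
    Integrable (remainder e S a) μ := by
  have h : MemLp (fun z : H => z - a) 2 μ :=
    (IsGaussian.memLp_two_id (μ := μ)).sub (memLp_const a)
  refine (h.integrable_norm_pow (by norm_num)).mono'
    (continuous_remainder e S a).measurable.aestronglyMeasurable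
    (Filter.Eventually.of_forall fun z => ?_)
  rw [Real.norm_of_nonneg (remainder_nonneg e S a z)]
  exact remainder_le e S a z

/-- Coordinate `j` is independent of the remainder over the other indices, whose exponential moment
is `M`. One `M` serves every `g`, so comparing `g = x²` with `g = 1` needs neither its value nor its
finiteness. -/
lemma IsEigenbasis.lintegral_coord_mul_exp_remainder
    (he : IsEigenbasis (covarianceOperator μ) e σ σ₁ S) (h0 : ∫ z, z ∂μ = 0) (a : H) {j : ι}
    (hj : j ∉ S) : ∃ M : ℝ≥0∞, ∀ g : ℝ → ℝ≥0∞, Measurable g →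
      ∫⁻ z, g ((⟪z, e j⟫ - ⟪a, e j⟫) / σ₁) *
        ENNReal.ofReal (Real.exp (remainder e S a z / σ₁ ^ 2 / 2)) ∂μ =
      (∫⁻ x, g x * ENNReal.ofReal (Real.exp (x ^ 2 / 2))
        ∂gaussianReal (-(⟪a, e j⟫ / σ₁)) (σ j ^ 2 / σ₁ ^ 2).toNNReal) * M := by
  classical
  have hm := (continuous_remainder e (insert j S) a).measurable
  refine ⟨∫⁻ z, ENNReal.ofReal (Real.exp (remainder e (insert j S) a z / σ₁ ^ 2 / 2)) ∂μ,
    fun g hg => ?_⟩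
  have hind := indepFun_inner_remainder h0 e (insert j S) a (fun _ : Unit => e j)
    fun _ h hh => by
      rw [he.inner_apply, real_inner_comm, hh j (Finset.mem_insert_self j S), mul_zero]
  have hind2 := hind.comp
    (φ := fun x => g ((x () - ⟪a, e j⟫) / σ₁) *
      ENNReal.ofReal (Real.exp (((x () - ⟪a, e j⟫) / σ₁) ^ 2 / 2)))
    (ψ := fun r => ENNReal.ofReal (Real.exp (r / σ₁ ^ 2 / 2))) (by fun_prop) (by fun_prop)
  have hmul := lintegral_mul_eq_lintegral_mul_lintegral_of_indepFun (by fun_prop) (by fun_prop)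
    hind2
  rw [← he.map_coord h0 a j, lintegral_map (by fun_prop) (by fun_prop)]
  refine Eq.trans ?_ (hmul.trans ?_)
  · refine lintegral_congr fun z => ?_
    simp only [Pi.mul_apply, Function.comp_apply]
    rw [mul_assoc, ← ENNReal.ofReal_mul (Real.exp_pos _).le, ← Real.exp_add, real_inner_comm,
      remainder_insert e hj]
    congr 3
    rw [div_pow, real_inner_comm]
    ring
  · simp only [Function.comp_def, real_inner_comm]

/-- Expand only the factor in front of the exponential into coordinates: each term reduces to the
one-dimensional tilted second moment, and `κ` is uniform in `j` by the spectral gap. -/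
lemma IsEigenbasis.lintegral_remainder_mul_exp_le
    (he : IsEigenbasis (covarianceOperator μ) e σ σ₁ S) (h0 : ∫ z, z ∂μ = 0) (a : H) :
    ∫⁻ z, ENNReal.ofReal (remainder e S a z / σ₁ ^ 2) *
        ENNReal.ofReal (Real.exp (remainder e S a z / σ₁ ^ 2 / 2)) ∂μ ≤
      ENNReal.ofReal ((1 - nextEigenvalue σ S / σ₁ ^ 2)⁻¹ ^ 2) *
        (∫⁻ z, ENNReal.ofReal (remainder e S a z / σ₁ ^ 2) ∂μ) *
        ∫⁻ z, ENNReal.ofReal (Real.exp (remainder e S a z / σ₁ ^ 2 / 2)) ∂μ := by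
  have := countable_of_hilbertBasis e
  have hm := (continuous_remainder e S a).measurable
  set κ := (1 - nextEigenvalue σ S / σ₁ ^ 2)⁻¹
  have hsum : ∀ z, ENNReal.ofReal (remainder e S a z / σ₁ ^ 2) =
      ∑' j : {j : ι // j ∉ S}, ENNReal.ofReal (((⟪z, e j⟫ - ⟪a, e j⟫) / σ₁) ^ 2) := fun z => by
    have h := hasSum_remainder_div e S a z σ₁
    rw [← h.tsum_eq, ENNReal.ofReal_tsum_of_nonneg (fun _ => sq_nonneg _) h.summable]
  have h1 : ∫⁻ z, ENNReal.ofReal (remainder e S a z / σ₁ ^ 2) *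
        ENNReal.ofReal (Real.exp (remainder e S a z / σ₁ ^ 2 / 2)) ∂μ =
      ∑' j : {j : ι // j ∉ S}, ∫⁻ z, ENNReal.ofReal (((⟪z, e j⟫ - ⟪a, e j⟫) / σ₁) ^ 2) *
        ENNReal.ofReal (Real.exp (remainder e S a z / σ₁ ^ 2 / 2)) ∂μ := by
    rw [← lintegral_tsum fun j => by fun_prop]
    refine lintegral_congr fun z => ?_
    rw [hsum, ENNReal.tsum_mul_right]
  have h2 : ∫⁻ z, ENNReal.ofReal (remainder e S a z / σ₁ ^ 2) ∂μ =
      ∑' j : {j : ι // j ∉ S}, ∫⁻ z, ENNReal.ofReal (((⟪z, e j⟫ - ⟪a, e j⟫) / σ₁) ^ 2) ∂μ := by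
    rw [← lintegral_tsum fun j => by fun_prop]
    exact lintegral_congr hsum
  rw [h1, h2, ← ENNReal.tsum_mul_left, ← ENNReal.tsum_mul_right]
  refine ENNReal.tsum_le_tsum fun j => ?_
  obtain ⟨M, hM⟩ := he.lintegral_coord_mul_exp_remainder h0 a j.2
  have hM1 := hM 1 measurable_one
  simp only [Pi.one_apply, one_mul] at hM1
  have h3 : ∫⁻ z, ENNReal.ofReal (((⟪z, e j⟫ - ⟪a, e j⟫) / σ₁) ^ 2) ∂μ =
      ∫⁻ x, ENNReal.ofReal (x ^ 2)
        ∂gaussianReal (-(⟪a, e j⟫ / σ₁)) (σ j ^ 2 / σ₁ ^ 2).toNNReal := by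
    rw [← he.map_coord h0 a j, lintegral_map (by fun_prop) (by fun_prop)]
  rw [hM (fun x => ENNReal.ofReal (x ^ 2)) (by fun_prop), hM1, h3, ← mul_assoc]
  gcongr
  exact lintegral_sq_mul_exp_sq_gaussianReal_le _ κ (he.toNNReal_lt_one j.2) (he.inv_one_sub_le j.2)

/-- Finite partial sums are handled by independence and the one-dimensional bound, with an estimate
uniform in the finite set; monotone convergence then passes to the full series. Its role is to give
finiteness. -/
lemma IsEigenbasis.lintegral_exp_remainder_le
    (he : IsEigenbasis (covarianceOperator μ) e σ σ₁ S) (h0 : ∫ z, z ∂μ = 0) (a : H) :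
    ∫⁻ z, ENNReal.ofReal (Real.exp (remainder e S a z / σ₁ ^ 2 / 2)) ∂μ ≤
      ENNReal.ofReal (Real.exp ((1 - nextEigenvalue σ S / σ₁ ^ 2)⁻¹ / 2 *
        ∫ z, remainder e S a z / σ₁ ^ 2 ∂μ)) := by
  have := countable_of_hilbertBasis e
  have hpos := he.pos
  set κ := (1 - nextEigenvalue σ S / σ₁ ^ 2)⁻¹ with hκ
  have hκ0 : 0 ≤ κ := by
    have : nextEigenvalue σ S / σ₁ ^ 2 < 1 := (div_lt_one (by positivity)).2 he.nextEigenvalue_lt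
    exact inv_nonneg.2 (by linarith)
  set Z : {j : ι // j ∉ S} → H → ℝ := fun j z => (⟪z, e j⟫ - ⟪a, e j⟫) / σ₁ with hZ
  have hZm : ∀ j, Measurable (Z j) := fun j => by fun_prop
  have hfin : ∀ G : Finset {j : ι // j ∉ S},
      ∫⁻ z, ENNReal.ofReal (Real.exp (∑ j ∈ G, Z j z ^ 2 / 2)) ∂μ ≤
        ENNReal.ofReal (Real.exp (κ / 2 * ∫ z, remainder e S a z / σ₁ ^ 2 ∂μ)) := by
    intro G
    have hind : iIndepFun (fun (j : G) z => ⟪e j, z⟫) μ := by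
      refine iIndepFun_inner h0 (fun j : G => e j) fun i j hij => ?_
      have hij' : ((i : {j : ι // j ∉ S}) : ι) ≠ j := fun h =>
        hij (Subtype.ext (Subtype.ext h))
      rw [he.inner_apply, e.orthonormal.2 hij', mul_zero]
    have hind2 := hind.comp (fun j x =>
      ENNReal.ofReal (Real.exp (((x - ⟪a, e j⟫) / σ₁) ^ 2 / 2))) (fun j => by fun_prop)
    have hprod := lintegral_prod_eq_prod_lintegral_of_indepFun Finset.univ _ hind2
      (fun j => by fun_prop)
    calc ∫⁻ z, ENNReal.ofReal (Real.exp (∑ j ∈ G, Z j z ^ 2 / 2)) ∂μ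
        = ∏ j : G, ∫⁻ z, ENNReal.ofReal (Real.exp (Z j z ^ 2 / 2)) ∂μ := by
          simp only [Function.comp_apply] at hprod
          have hcomm : ∀ (j : ι) (z : H), ⟪e j, z⟫ = ⟪z, e j⟫ := fun j z => real_inner_comm _ _
          simp only [hcomm] at hprod
          refine Eq.trans (lintegral_congr fun z => ?_) hprod
          rw [Real.exp_sum, ENNReal.ofReal_prod_of_nonneg fun _ _ => (Real.exp_pos _).le,
            ← Finset.prod_coe_sort]
      _ ≤ ∏ j : G, ENNReal.ofReal (Real.exp (κ / 2 * ∫ z, Z j z ^ 2 ∂μ)) := by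
          refine Finset.prod_le_prod' fun j _ => ?_
          have hlt := he.toNNReal_lt_one (j : {j : ι // j ∉ S}).2
          have hsq : ∫ z, Z j z ^ 2 ∂μ = (σ j ^ 2 / σ₁ ^ 2).toNNReal + (-(⟪a, e j⟫ / σ₁)) ^ 2 := by
            rw [integral_eq_lintegral_of_nonneg_ae (Filter.Eventually.of_forall fun _ =>
              sq_nonneg _) (by fun_prop), ← ENNReal.toReal_ofReal (r := _ + _) (by positivity),
              ← lintegral_ofReal_sq_gaussianReal, ← he.map_coord h0 a,
              lintegral_map (by fun_prop) (by fun_prop)]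
          rw [hsq]
          refine le_trans (le_of_eq ?_) (lintegral_exp_sq_gaussianReal_le _ κ hlt
            (he.inv_one_sub_le (j : {j : ι // j ∉ S}).2))
          rw [← he.map_coord h0 a, lintegral_map (by fun_prop) (by fun_prop)]
      _ = ENNReal.ofReal (Real.exp (κ / 2 * ∑ j ∈ G, ∫ z, Z j z ^ 2 ∂μ)) := by
          rw [Finset.mul_sum, Real.exp_sum,
            ENNReal.ofReal_prod_of_nonneg fun _ _ => (Real.exp_pos _).le]
          exact Finset.prod_coe_sort G fun j =>
            ENNReal.ofReal (Real.exp (κ / 2 * ∫ z, Z j z ^ 2 ∂μ))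
      _ ≤ _ := by
          have hint : Integrable (fun z => remainder e S a z / σ₁ ^ 2) μ :=
            (integrable_remainder e S a).div_const _
          have hle : ∀ G : Finset {j : ι // j ∉ S}, ∀ z,
              ∑ j ∈ G, Z j z ^ 2 ≤ remainder e S a z / σ₁ ^ 2 := fun G z =>
            sum_le_hasSum G (fun _ _ => sq_nonneg _) (hasSum_remainder_div e S a z σ₁)
          have hint2 : ∀ j, Integrable (fun z => Z j z ^ 2) μ := fun j =>
            hint.mono' (by fun_prop) (Filter.Eventually.of_forall fun z => by
              rw [Real.norm_of_nonneg (sq_nonneg _)]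
              simpa using hle {j} z)
          gcongr
          rw [← integral_finsetSum _ fun j _ => hint2 j]
          exact integral_mono (integrable_finsetSum _ fun j _ => hint2 j) hint (hle G)
  calc ∫⁻ z, ENNReal.ofReal (Real.exp (remainder e S a z / σ₁ ^ 2 / 2)) ∂μ
      ≤ ∫⁻ z, ⨆ G : Finset {j : ι // j ∉ S},
          ENNReal.ofReal (Real.exp (∑ j ∈ G, Z j z ^ 2 / 2)) ∂μ := by
        refine lintegral_mono fun z => ?_
        have h := (hasSum_remainder_div e S a z σ₁).div_const 2
        exact le_of_tendsto' ((ENNReal.continuous_ofReal.tendsto _).comp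
          ((Real.continuous_exp.tendsto _).comp h)) fun G =>
            le_iSup (fun G => ENNReal.ofReal (Real.exp (∑ j ∈ G, Z j z ^ 2 / 2))) G
    _ = ⨆ G : Finset {j : ι // j ∉ S},
          ∫⁻ z, ENNReal.ofReal (Real.exp (∑ j ∈ G, Z j z ^ 2 / 2)) ∂μ := by
        refine lintegral_iSup_directed (fun G => by fun_prop) ?_
        refine Monotone.directed_le fun G G' hGG z => ?_
        refine ENNReal.ofReal_le_ofReal (Real.exp_le_exp.2 ?_)
        exact Finset.sum_le_sum_of_subset_of_nonneg hGG fun _ _ _ => by positivity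
    _ ≤ _ := iSup_le hfin

end

/-! ### Reduction to the noncentral chi-square law -/

section

variable {ι H : Type*} [NormedAddCommGroup H] [InnerProductSpace ℝ H]
  {e : HilbertBasis ι ℝ H} {σ : ι → ℝ} {σ₁ : ℝ} {S : Finset ι}

/-- A frame of the top eigenspace, normalized to unit variance, whose first vector points in the
direction opposite to the projection of `a`. -/
lemma IsEigenbasis.exists_frame {V : H →L[ℝ] H} (he : IsEigenbasis V e σ σ₁ S) {n : ℕ}
    (hS : S.card = n + 1) (a : H) (ha : 0 < topNorm e S a) :
    ∃ g : Fin (n + 1) → H,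
      (∀ i h, (∀ j ∈ S, ⟪h, e j⟫ = 0) → ⟪V (g i), h⟫ = 0) ∧
      (∀ i l, ⟪V (g i), g l⟫ = if i = l then 1 else 0) ∧
      ⟪g 0, a⟫ = -(topNorm e S a / σ₁) ∧ (∀ i : Fin n, ⟪g i.succ, a⟫ = 0) ∧
      ∀ z, ∑ j ∈ S, ⟪z, e j⟫ ^ 2 = σ₁ ^ 2 * ∑ i, ⟪g i, z⟫ ^ 2 := by
  classical
  set A := topNorm e S a with hA
  have hσ := he.pos
  set L : H → EuclideanSpace ℝ S := fun z => WithLp.toLp 2 fun j => ⟪z, e j⟫ with hL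
  -- The minus sign is needed because the coordinates are those of `z - a`: the first one then has
  -- mean `+A / σ₁`.
  set α : EuclideanSpace ℝ S := (-A⁻¹) • L a with hα
  have hLnorm : ∀ z, ‖L z‖ ^ 2 = ∑ j ∈ S, ⟪z, e j⟫ ^ 2 := by
    intro z
    rw [EuclideanSpace.norm_sq_eq, ← Finset.sum_coe_sort S]
    simp [hL]
  have hLa : ‖L a‖ = A := by
    rw [hA, topNorm, ← hLnorm, Real.sqrt_sq (norm_nonneg _)]
  have hα1 : ‖α‖ = 1 := by
    rw [hα, norm_smul, hLa, norm_neg, Real.norm_of_nonneg (by positivity),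
      inv_mul_cancel₀ ha.ne']
  have hcard : Module.finrank ℝ (EuclideanSpace ℝ S) = Fintype.card (Fin (n + 1)) := by
    simp [hS]
  obtain ⟨b, hb⟩ := Orthonormal.exists_orthonormalBasis_extension_of_card_eq hcard
    (v := fun _ => α) (s := {0})
    ⟨fun _ => hα1, fun i j hij => absurd (Subsingleton.elim i j) hij⟩
  have hb0 : b 0 = α := hb 0 rfl
  have hLa' : L a = (-A) • b 0 := by
    rw [hb0, hα, smul_smul, neg_mul_neg, mul_inv_cancel₀ ha.ne', one_smul]
  set g : Fin (n + 1) → H := fun i => σ₁⁻¹ • ∑ j : S, (b i) j • e j with hg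
  have hgin : ∀ i z, ⟪g i, z⟫ = σ₁⁻¹ * ⟪b i, L z⟫ := by
    intro i z
    simp only [hg, real_inner_smul_left, sum_inner, hL, PiLp.inner_apply]
    congr 1
    refine Finset.sum_congr rfl fun j _ => ?_
    simp [real_inner_comm, mul_comm]
  have hLg : ∀ i, L (g i) = σ₁⁻¹ • b i := by
    intro i
    ext j
    simp only [hL, hg, real_inner_smul_left, sum_inner, PiLp.smul_apply, smul_eq_mul]
    congr 1
    rw [Finset.sum_eq_single j]
    · rw [real_inner_self_eq_norm_sq, e.orthonormal.1]; simp
    · intro l _ hl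
      have hl' : (l : ι) ≠ j := fun h => hl (Subtype.ext h)
      rw [e.orthonormal.2 hl', mul_zero]
    · simp
  have hVg : ∀ i, V (g i) = σ₁ ^ 2 • g i := by
    intro i
    simp only [hg, map_smul, map_sum, he.eigen]
    rw [smul_comm (σ₁ ^ 2), Finset.smul_sum (r := σ₁ ^ 2)]
    congr 1
    refine Finset.sum_congr rfl fun j _ => ?_
    rw [he.top j j.2, smul_comm]
  refine ⟨g, ?_, ?_, ?_, ?_, ?_⟩
  · intro i h hh
    have : L h = 0 := by
      ext j
      simpa [hL] using hh j j.2
    rw [hVg, real_inner_smul_left, hgin, this, inner_zero_right, mul_zero, mul_zero]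
  · intro i l
    rw [hVg, real_inner_smul_left, hgin, hLg, real_inner_smul_right,
      orthonormal_iff_ite.1 b.orthonormal]
    split_ifs
    · field_simp
    · simp
  · rw [hgin, hLa', real_inner_smul_right, real_inner_self_eq_norm_sq, b.orthonormal.1]
    ring
  · intro i
    rw [hgin, hLa', real_inner_smul_right, b.orthonormal.2 (Fin.succ_ne_zero i)]
    simp
  · intro z
    rw [← hLnorm, ← b.sum_sq_norm_inner_right, Finset.mul_sum]
    refine Finset.sum_congr rfl fun i _ => ?_
    rw [hgin, Real.norm_eq_abs, sq_abs]
    field_simp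

lemma map_sum_sq_pi_gaussianReal (n : ℕ) (A : ℝ) (m : Fin (n + 2) → ℝ) (hm0 : m 0 = A)
    (hm : ∀ i : Fin (n + 1), m i.succ = 0) :
    (Measure.pi fun i => gaussianReal (m i) 1).map (fun x => ∑ i, x i ^ 2) =
      noncentralChiSq n A := by
  have h := measurePreserving_piFinSuccAbove (fun i => gaussianReal (m i) 1) 0
  simp only [Fin.succAbove_zero, hm, hm0] at h
  rw [noncentralChiSq, ← h.map_eq, Measure.map_map (by fun_prop) (by fun_prop)]
  congr 1
  funext x
  simp [Fin.sum_univ_succ, MeasurableEquiv.piFinSuccAbove, Fin.insertNthEquiv, Fin.tail]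

variable [CompleteSpace H] [SecondCountableTopology H] [MeasurableSpace H] [BorelSpace H]
  {μ : Measure H} [IsGaussian μ]

/-- In the frame of `exists_frame`, `‖z - a‖² / σ₁²` is a noncentral chi-square variable plus an
independent multiple of the remainder; Fubini integrates out the former first. -/
lemma IsEigenbasis.measure_norm_sub_gt (he : IsEigenbasis (covarianceOperator μ) e σ σ₁ S)
    (h0 : ∫ z, z ∂μ = 0) {n : ℕ} (hS : S.card = n + 2) (a : H) (ha : 0 < topNorm e S a)
    {r : ℝ} (hr : 0 ≤ r) :
    μ {z | r < ‖z - a‖} = ∫⁻ z, noncentralChiSq n (topNorm e S a / σ₁)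
      {q | (r / σ₁) ^ 2 < q + remainder e S a z / σ₁ ^ 2} ∂μ := by
  have hσ := he.pos
  obtain ⟨g, hgS, hgV, hga0, hga, hgsum⟩ := he.exists_frame hS a ha
  have hRm := (continuous_remainder e S a).measurable
  set T : H → ℝ := fun z => ∑ i, (⟪g i, z⟫ - ⟪g i, a⟫) ^ 2 with hT
  have hTm : Measurable T := by fun_prop
  have hmapT : μ.map T = noncentralChiSq n (topNorm e S a / σ₁) := by
    have hind := (iIndepFun_inner h0 g fun i l hil => by rw [hgV, if_neg hil]).comp
      (fun i x => x - ⟪g i, a⟫) (fun i => by fun_prop)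
    rw [iIndepFun_iff_map_fun_eq_pi_map (fun i => by fun_prop)] at hind
    simp only [Function.comp_def, map_inner_sub_eq_gaussianReal h0, hgV, if_true,
      Real.toNNReal_one] at hind
    rw [← map_sum_sq_pi_gaussianReal n _ (fun i => -⟪g i, a⟫) (by rw [hga0, neg_neg])
      (fun i => by rw [hga, neg_zero]), ← hind, Measure.map_map (by fun_prop) (by fun_prop)]
    rfl
  have hφ : Measurable fun x : Fin (n + 2) → ℝ => ∑ i, (x i - ⟪g i, a⟫) ^ 2 := by fun_prop
  have hindT : IndepFun T (remainder e S a) μ :=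
    (indepFun_inner_remainder h0 e S a g hgS).comp hφ measurable_id
  rw [indepFun_iff_map_prod_eq_prod_map_map hTm.aemeasurable hRm.aemeasurable] at hindT
  set D : Set (ℝ × ℝ) := {p | (r / σ₁) ^ 2 < p.1 + p.2 / σ₁ ^ 2} with hD
  have hDm : MeasurableSet D := measurableSet_lt (by fun_prop) (by fun_prop)
  have hset : {z | r < ‖z - a‖} = (fun z => (T z, remainder e S a z)) ⁻¹' D := by
    ext z
    have h1 : ‖z - a‖ ^ 2 = σ₁ ^ 2 * T z + remainder e S a z := by
      rw [remainder_eq, hgsum]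
      simp only [hT, inner_sub_right]
      ring
    have h2 : T z + remainder e S a z / σ₁ ^ 2 = ‖z - a‖ ^ 2 / σ₁ ^ 2 := by
      rw [h1]; field_simp
    simp only [hD, Set.mem_ofPred_eq, Set.mem_preimage]
    rw [h2, div_pow, div_lt_div_iff_of_pos_right (by positivity),
      pow_lt_pow_iff_left₀ hr (norm_nonneg _) two_ne_zero]
  rw [hset, ← Measure.map_apply (by fun_prop) hDm, hindT, Measure.prod_apply_symm hDm, hmapT,
    lintegral_map _ hRm]
  · rfl
  · exact measurable_measure_prodMk_right hDm

/-- The tail of `‖z - a‖` is comparable to the exponential moment of the remainder. -/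
lemma exists_measure_norm_sub_gt_bounds (n : ℕ) (hn : 2 ≤ n) :
    ∃ c C : ℝ, 0 < c ∧ 0 < C ∧
      ∀ {H : Type*} [NormedAddCommGroup H] [InnerProductSpace ℝ H] [CompleteSpace H]
        [SecondCountableTopology H] [MeasurableSpace H] [BorelSpace H]
        {μ : Measure H} [IsGaussian μ] (_ : ∫ z, z ∂μ = 0)
        {ι : Type*} {e : HilbertBasis ι ℝ H} {σ : ι → ℝ} {σ₁ : ℝ} {S : Finset ι}
        (_ : IsEigenbasis (covarianceOperator μ) e σ σ₁ S) (_ : S.card = n + 2)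
        (a : H) (A : ℝ) (_ : A = topNorm e S a) (_ : 0 < A) (r U : ℝ) (_ : 2 * A ≤ r)
        (_ : σ₁ ^ 2 ≤ A * r) (_ : U ≤ r ^ 2 / 2) (_ : A * U ≤ ((n : ℝ) - 1) / 4 * (σ₁ ^ 2 * r))
        (_ : 2 * (((1 - nextEigenvalue σ S / σ₁ ^ 2)⁻¹ ^ 2) * ∫ z, remainder e S a z ∂μ) ≤ U),
        (ENNReal.ofReal (c * ((A / σ₁) ^ (-(((n : ℝ) + 1) / 2)) *
            (r / σ₁) ^ (((n : ℝ) + 1) / 2 - 1) * Real.exp (-(r / σ₁ - A / σ₁) ^ 2 / 2))) *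
          ∫⁻ z, ENNReal.ofReal (Real.exp (remainder e S a z / σ₁ ^ 2 / 2)) ∂μ ≤
            μ {z | r < ‖z - a‖}) ∧
        μ {z | r < ‖z - a‖} ≤ ENNReal.ofReal (C * ((A / σ₁) ^ (-(((n : ℝ) + 1) / 2)) *
            (r / σ₁) ^ (((n : ℝ) + 1) / 2 - 1) * Real.exp (-(r / σ₁ - A / σ₁) ^ 2 / 2))) *
          ∫⁻ z, ENNReal.ofReal (Real.exp (remainder e S a z / σ₁ ^ 2 / 2)) ∂μ := by
  -- `B = (n - 1) / 4` is `(k - 3) / 4` for `k = n + 2`, the constant supplied by the threshold on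
  -- `r`. The lower constant is halved below because only half of the exponential moment is kept.
  obtain ⟨c, C, hc, hC, hbd⟩ := exists_noncentralChiSq_tail_bounds n (by omega) (((n : ℝ) - 1) / 4)
  refine ⟨c / 2, C, by positivity, hC, ?_⟩
  intro H _ _ _ _ _ _ μ _ h0 ι e σ σ₁ S he hS a A hA hA0 r U hAr hσr hUr hAU hU
  have hσ := he.pos
  have hr : 0 < r := by linarith
  have hRm := (continuous_remainder e S a).measurable
  have hr1 : 1 ≤ r / σ₁ := by
    rw [one_le_div hσ]
    nlinarith
  have hAr' : 2 * (A / σ₁) ≤ r / σ₁ := by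
    rw [mul_div_assoc']
    gcongr
  have hAr1 : 1 ≤ A / σ₁ * (r / σ₁) := by
    rw [div_mul_div_comm, one_le_div (by positivity)]
    nlinarith
  have hbd' := fun z => hbd (A / σ₁) (r / σ₁) (remainder e S a z / σ₁ ^ 2) (by positivity) hr1 hAr'
    hAr1 (div_nonneg (remainder_nonneg e S a z) (by positivity))
  rw [he.measure_norm_sub_gt h0 hS a (hA ▸ hA0) hr.le, ← hA]
  set K := (A / σ₁) ^ (-(((n : ℝ) + 1) / 2)) * (r / σ₁) ^ (((n : ℝ) + 1) / 2 - 1) *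
    Real.exp (-(r / σ₁ - A / σ₁) ^ 2 / 2) with hK
  set ρ : H → ℝ := fun z => remainder e S a z / σ₁ ^ 2 with hρ
  have hρm : Measurable ρ := by fun_prop
  have hρ0 : ∀ z, 0 ≤ ρ z := fun z => div_nonneg (remainder_nonneg e S a z) (by positivity)
  constructor
  · set κ := (1 - nextEigenvalue σ S / σ₁ ^ 2)⁻¹ with hκ
    have hρint : Integrable ρ μ := (integrable_remainder e S a).div_const _
    have hle : ∫⁻ z, ENNReal.ofReal (ρ z) * ENNReal.ofReal (Real.exp (ρ z / 2)) ∂μ ≤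
        ENNReal.ofReal (κ ^ 2 * ∫ z, ρ z ∂μ) * ∫⁻ z, ENNReal.ofReal (Real.exp (ρ z / 2)) ∂μ := by
      rw [ENNReal.ofReal_mul (sq_nonneg κ), ofReal_integral_eq_lintegral_ofReal hρint
        (Filter.Eventually.of_forall hρ0)]
      exact he.lintegral_remainder_mul_exp_le h0 a
    have hKU : 2 * (κ ^ 2 * ∫ z, ρ z ∂μ) ≤ U / σ₁ ^ 2 := by
      rw [hρ, integral_div, mul_div_assoc', mul_div_assoc']
      gcongr
    have hhalf := lintegral_le_two_mul_setLIntegral (μ := μ) hρm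
      (E := fun z => ENNReal.ofReal (Real.exp (ρ z / 2))) (by fun_prop)
      (ne_top_of_le_ne_top ENNReal.ofReal_ne_top (he.lintegral_exp_remainder_le h0 a)) hKU
      (mul_nonneg (sq_nonneg κ) (integral_nonneg hρ0)) hle
    have hms : MeasurableSet {z | ρ z ≤ U / σ₁ ^ 2} := measurableSet_le hρm measurable_const
    calc ENNReal.ofReal (c / 2 * K) * ∫⁻ z, ENNReal.ofReal (Real.exp (ρ z / 2)) ∂μ
        ≤ ENNReal.ofReal (c / 2 * K) * (2 * ∫⁻ z in {z | ρ z ≤ U / σ₁ ^ 2},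
            ENNReal.ofReal (Real.exp (ρ z / 2)) ∂μ) := by gcongr
      _ = ∫⁻ z in {z | ρ z ≤ U / σ₁ ^ 2},
            ENNReal.ofReal (c * K) * ENNReal.ofReal (Real.exp (ρ z / 2)) ∂μ := by
          rw [lintegral_const_mul' _ _ ENNReal.ofReal_ne_top, ← mul_assoc]
          congr 1
          have h2 : (2 : ℝ≥0∞) = ENNReal.ofReal 2 := by simp
          rw [h2, ← ENNReal.ofReal_mul (by positivity)]
          congr 1
          ring
      _ ≤ ∫⁻ z in {z | ρ z ≤ U / σ₁ ^ 2},
            noncentralChiSq n (A / σ₁) {q | (r / σ₁) ^ 2 < q + ρ z} ∂μ := by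
          refine setLIntegral_mono' hms fun z hz => (hbd' z).2 ?_ ?_
          · have h1 : U / σ₁ ^ 2 ≤ r ^ 2 / 2 / σ₁ ^ 2 := by gcongr
            have h2 : (r / σ₁) ^ 2 / 2 = r ^ 2 / 2 / σ₁ ^ 2 := by rw [div_pow]; ring
            rw [h2]
            exact le_trans hz h1
          · calc A / σ₁ * ρ z ≤ A / σ₁ * (U / σ₁ ^ 2) := by
                  gcongr
                  exact hz
              _ = A * U / σ₁ ^ 3 := by field_simp
              _ ≤ ((n : ℝ) - 1) / 4 * (σ₁ ^ 2 * r) / σ₁ ^ 3 := by gcongr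
              _ = _ := by field_simp
      _ ≤ _ := setLIntegral_le_lintegral _ _
  · rw [← lintegral_const_mul' _ _ ENNReal.ofReal_ne_top]
    exact lintegral_mono fun z => (hbd' z).1

/-- Each summand of the threshold pays for one condition: `2A` and `s² / A` give the first two, and
the two terms of `uStarStar` give the last two. The first term has coefficient at least `2`, and the
second is the square of `4 A u / (s² (k - 3))`. -/
lemma threshold_bounds {k : ℕ} (hk : 4 ≤ k) {A s u r : ℝ} (hA : 0 < A) (hs : 0 < s) (hu : 0 ≤ u)
    (hr : s ^ 2 / A + 2 * A + √(uStarStar k s A u) < r) :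
    2 * A ≤ r ∧ s ^ 2 ≤ A * r ∧ u ≤ r ^ 2 / 2 ∧ A * u ≤ ((k : ℝ) - 3) / 4 * (s ^ 2 * r) := by
  have hk' : (4 : ℝ) ≤ k := by exact_mod_cast hk
  have hk3 : 0 < (k : ℝ) - 3 := by linarith
  have h1 : 0 < s ^ 2 / A := by positivity
  have h2 := Real.sqrt_nonneg (uStarStar k s A u)
  have hr0 : 0 < r := by linarith
  have hfst : 0 ≤ 5.625 * ((k : ℝ) - 1) ^ 2 / ((k : ℝ) - 3) * u := by positivity
  have hsnd : 16 * A ^ 2 / s ^ 4 * u ^ 2 / ((k : ℝ) - 3) ^ 2 =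
      (4 * A * u / (s ^ 2 * ((k : ℝ) - 3))) ^ 2 := by field_simp; ring
  have hW : uStarStar k s A u ≤ r ^ 2 := by
    refine (Real.sqrt_le_left hr0.le).1 ?_
    linarith
  rw [uStarStar, hsnd] at hW
  refine ⟨by linarith, ?_, ?_, ?_⟩
  · have : s ^ 2 / A ≤ r := by linarith
    rw [div_le_iff₀ hA] at this
    linarith
  · have h5 : 2 ≤ 5.625 * ((k : ℝ) - 1) ^ 2 / ((k : ℝ) - 3) := by
      rw [le_div_iff₀ hk3]
      nlinarith
    nlinarith [mul_le_mul_of_nonneg_right h5 hu,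
      sq_nonneg (4 * A * u / (s ^ 2 * ((k : ℝ) - 3)))]
  · have h6 : 4 * A * u / (s ^ 2 * ((k : ℝ) - 3)) ≤ r := by
      refine le_of_sq_le_sq ?_ hr0.le
      linarith
    rw [div_le_iff₀ (by positivity)] at h6
    linarith

/-- The chi-square tail factor and the normalization in the theorem are exact inverses, so the
constants carry over unchanged. -/
lemma normalization_eq_one {A r s m : ℝ} (hA : 0 < A) (hr : 0 < r) (hs : 0 < s) :
    (A / s) ^ (-(m + 1)) * (r / s) ^ m * Real.exp (-(r / s - A / s) ^ 2 / 2) *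
      (Real.exp ((r - A) ^ 2 / (2 * s ^ 2)) * s⁻¹ * r ^ (-m) * A ^ (m + 1)) = 1 := by
  have e1 : Real.exp (-(r / s - A / s) ^ 2 / 2) * Real.exp ((r - A) ^ 2 / (2 * s ^ 2)) = 1 := by
    rw [← Real.exp_add, Real.exp_eq_one_iff]
    field_simp
    ring
  have e2 : (A / s) ^ (-(m + 1)) * A ^ (m + 1) = s ^ (m + 1) := by
    rw [Real.div_rpow hA.le hs.le, Real.rpow_neg hs.le, Real.rpow_neg hA.le]
    field_simp
  have e3 : (r / s) ^ m * r ^ (-m) = s ^ (-m) := by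
    rw [Real.div_rpow hr.le hs.le, Real.rpow_neg hs.le, Real.rpow_neg hr.le]
    field_simp
  have e4 : s ^ (m + 1) * s ^ (-m) * s⁻¹ = 1 := by
    rw [← Real.rpow_add hs, ← Real.rpow_neg_one s, ← Real.rpow_add hs]
    ring_nf
    exact Real.rpow_zero s
  calc _ = (Real.exp (-(r / s - A / s) ^ 2 / 2) * Real.exp ((r - A) ^ 2 / (2 * s ^ 2))) *
        (((A / s) ^ (-(m + 1)) * A ^ (m + 1)) * ((r / s) ^ m * r ^ (-m)) * s⁻¹) := by ring
    _ = 1 := by rw [e1, e2, e3, e4, one_mul]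

end

end GaussianTail

/-! ### Transfer to the random element and conclusion -/

theorem theorem16 (k : ℕ) (hk : 4 ≤ k) :
    ∃ c₉ c₁₀ : ℝ, 0 < c₉ ∧ 0 < c₁₀ ∧
      ∀ (H : Type*) [NormedAddCommGroup H] [InnerProductSpace ℝ H] [CompleteSpace H]
        [SecondCountableTopology H] [MeasurableSpace H] [BorelSpace H]
        (Ω : Type*) [MeasurableSpace Ω] (P : Measure Ω) [IsProbabilityMeasure P]
        (Y : Ω → H) (_ : HasGaussianLaw Y P) (_ : ∫ ω, Y ω ∂P = 0)
        (ι : Type*) (e : HilbertBasis ι ℝ H) (σ : ι → ℝ) (σ₁ : ℝ) (S : Finset ι)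
        (_ : GaussianTail.IsEigenbasis (covarianceOperator (P.map Y)) e σ σ₁ S)
        (_ : S.card = k)
        (a : H) (A : ℝ) (_ : A = GaussianTail.topNorm e S a) (_ : 0 < A)
        (R : Ω → ℝ) (_ : ∀ ω, R ω = GaussianTail.remainder e S a (Y ω))
        (r : ℝ)
        (_ : σ₁ ^ 2 / A + 2 * A
            + √(GaussianTail.uStarStar k σ₁ A
                (GaussianTail.u₀ k (σ₁ ^ 2) (GaussianTail.nextEigenvalue σ S) (∫ ω, R ω ∂P))) < r),
        Integrable (fun ω => Real.exp (R ω / (2 * σ₁ ^ 2))) P ∧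
        c₉ * ∫ ω, Real.exp (R ω / (2 * σ₁ ^ 2)) ∂P
          ≤ P.real {ω | r < ‖Y ω - a‖} * Real.exp ((r - A) ^ 2 / (2 * σ₁ ^ 2))
              * σ₁⁻¹ * r ^ (-(((k : ℝ) - 3) / 2)) * A ^ (((k : ℝ) - 1) / 2) ∧
        P.real {ω | r < ‖Y ω - a‖} * Real.exp ((r - A) ^ 2 / (2 * σ₁ ^ 2))
              * σ₁⁻¹ * r ^ (-(((k : ℝ) - 3) / 2)) * A ^ (((k : ℝ) - 1) / 2)
          ≤ c₁₀ * ∫ ω, Real.exp (R ω / (2 * σ₁ ^ 2)) ∂P := by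
  open GaussianTail in
  -- The `k` top coordinates are one shifted coordinate and `n + 1` centred ones.
  obtain ⟨n, rfl⟩ : ∃ n, k = n + 2 := ⟨k - 2, by omega⟩
  obtain ⟨c, C, hc, hC, hbd⟩ := exists_measure_norm_sub_gt_bounds n (by omega)
  refine ⟨c, C, hc, hC, ?_⟩
  intro H _ _ _ _ _ _ Ω _ P _ Y hY hmean ι e σ σ₁ S he hS a A hA hA0 R hR r hr
  have hYm : AEMeasurable Y P := hY.aemeasurable
  have := hY.isGaussian_map
  have hσ := he.pos
  have hRm := (continuous_remainder e S a).measurable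
  have h0 : ∫ z, z ∂P.map Y = 0 := by
    rw [integral_map hYm (by fun_prop), hmean]
  have hint : ∫ ω, R ω ∂P = ∫ z, remainder e S a z ∂P.map Y := by
    rw [integral_map hYm hRm.aestronglyMeasurable]
    exact integral_congr_ae (Filter.Eventually.of_forall hR)
  have hint0 : 0 ≤ ∫ z, remainder e S a z ∂P.map Y := integral_nonneg (remainder_nonneg e S a)
  rw [hint] at hr
  set m₀ := ∫ z, remainder e S a z ∂P.map Y with hm₀
  set U := u₀ (n + 2) (σ₁ ^ 2) (nextEigenvalue σ S) m₀ with hU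
  have hU0 : 0 ≤ U := by rw [hU, u₀]; positivity
  obtain ⟨hr1, hr2, hr3, hr4⟩ := threshold_bounds hk hA0 hσ hU0 hr
  have hr0 : 0 < r := by linarith
  -- Markov's inequality asks for twice the tilted mean bound `κ² E R`; `u₀` is `k` times that, and
  -- `k ≥ 1`.
  have hkU : 2 * (((1 - nextEigenvalue σ S / σ₁ ^ 2)⁻¹ ^ 2) * m₀) ≤ U := by
    rw [hU, u₀, inv_pow, mul_assoc]
    have : (1 : ℝ) ≤ ((n + 2 : ℕ) : ℝ) := by exact_mod_cast (by omega : 1 ≤ n + 2)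
    have h1 : 0 ≤ ((1 - nextEigenvalue σ S / σ₁ ^ 2) ^ 2)⁻¹ * m₀ := by positivity
    nlinarith
  obtain ⟨hlow, hup⟩ := hbd h0 he hS a A hA hA0 r U hr1 hr2 hr3
    (by push_cast at hr4; linarith) hkU
  have hfin := ne_top_of_le_ne_top ENNReal.ofReal_ne_top (he.lintegral_exp_remainder_le h0 a)
  have hR2 : ∀ ω, Real.exp (R ω / (2 * σ₁ ^ 2)) =
      Real.exp (remainder e S a (Y ω) / σ₁ ^ 2 / 2) := fun ω => by
    rw [hR, div_div, mul_comm]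
  have hlint : ∫⁻ z, ENNReal.ofReal (Real.exp (remainder e S a z / σ₁ ^ 2 / 2)) ∂P.map Y =
      ∫⁻ ω, ENNReal.ofReal (Real.exp (R ω / (2 * σ₁ ^ 2))) ∂P := by
    rw [lintegral_map' (by fun_prop) hYm]
    simp only [hR2]
  have hae : AEStronglyMeasurable (fun ω => Real.exp (R ω / (2 * σ₁ ^ 2))) P := by
    simp only [hR2]
    have : Measurable fun z => Real.exp (remainder e S a z / σ₁ ^ 2 / 2) := by fun_prop
    exact (this.comp_aemeasurable hYm).aestronglyMeasurable
  have hint1 : ∫ ω, Real.exp (R ω / (2 * σ₁ ^ 2)) ∂P =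
      (∫⁻ ω, ENNReal.ofReal (Real.exp (R ω / (2 * σ₁ ^ 2))) ∂P).toReal :=
    integral_eq_lintegral_of_nonneg_ae (Filter.Eventually.of_forall fun _ => (Real.exp_pos _).le)
      hae
  have hP : P.real {ω | r < ‖Y ω - a‖} = ((P.map Y) {z | r < ‖z - a‖}).toReal := by
    rw [Measure.map_apply_of_aemeasurable hYm (measurableSet_lt (by fun_prop) (by fun_prop))]
    rfl
  rw [hlint] at hlow hup hfin
  have e1 : ((n : ℝ) + 1) / 2 = (((n : ℝ) + 1) / 2 - 1) + 1 := by ring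
  have hnorm := normalization_eq_one (m := ((n : ℝ) + 1) / 2 - 1) hA0 hr0 hσ
  rw [← e1] at hnorm
  have e2 : (((n + 2 : ℕ) : ℝ) - 3) / 2 = ((n : ℝ) + 1) / 2 - 1 := by push_cast; ring
  have e3 : (((n + 2 : ℕ) : ℝ) - 1) / 2 = ((n : ℝ) + 1) / 2 := by push_cast; ring
  rw [e2, e3, hint1, hP]
  set K := (A / σ₁) ^ (-(((n : ℝ) + 1) / 2)) * (r / σ₁) ^ (((n : ℝ) + 1) / 2 - 1) *
    Real.exp (-(r / σ₁ - A / σ₁) ^ 2 / 2) with hK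
  set F := Real.exp ((r - A) ^ 2 / (2 * σ₁ ^ 2)) * σ₁⁻¹ * r ^ (-(((n : ℝ) + 1) / 2 - 1)) *
    A ^ (((n : ℝ) + 1) / 2) with hF
  set M := ∫⁻ ω, ENNReal.ofReal (Real.exp (R ω / (2 * σ₁ ^ 2))) ∂P with hM
  have hK0 : 0 ≤ K := by positivity
  have hF0 : 0 ≤ F := by positivity
  have hprob : (P.map Y) {z | r < ‖z - a‖} ≠ ⊤ := measure_ne_top _ _
  set p := (P.map Y) {z | r < ‖z - a‖} with hp
  have hassoc : p.toReal * Real.exp ((r - A) ^ 2 / (2 * σ₁ ^ 2)) * σ₁⁻¹ *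
      r ^ (-(((n : ℝ) + 1) / 2 - 1)) * A ^ (((n : ℝ) + 1) / 2) = p.toReal * F := by
    rw [hF]; ring
  rw [hassoc]
  refine ⟨⟨hae, ?_⟩, ?_, ?_⟩
  · rw [hasFiniteIntegral_iff_ofReal (Filter.Eventually.of_forall fun _ => (Real.exp_pos _).le)]
    exact lt_top_iff_ne_top.2 hfin
  · have h := ENNReal.toReal_mono hprob hlow
    rw [ENNReal.toReal_mul, ENNReal.toReal_ofReal (by positivity)] at h
    calc c * M.toReal = c * K * M.toReal * F := by linear_combination (-c * M.toReal) * hnorm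
      _ ≤ _ := by gcongr
  · have h := ENNReal.toReal_mono (ENNReal.mul_ne_top ENNReal.ofReal_ne_top hfin) hup
    rw [ENNReal.toReal_mul, ENNReal.toReal_ofReal (by positivity)] at h
    calc p.toReal * F ≤ C * K * M.toReal * F := by gcongr
      _ = _ := by linear_combination (C * M.toReal) * hnorm
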